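/- **Completeness Theorem for the first-order logic $QLET_F$.** Let $\mathcal S=\langle\mathcal C,\mathcal P\rangle$ be a signature and let $\Gamma\cup\{A\}$ be a set of sentences of $\mathcal S$. If $\Gamma\vDash A$, then $\Gamma\vdash A$. The notions are the following. *Language.* A signature $\mathcal S=\langle\mathcal C,\mathcal P\rangle$ consists of an infinite set $\mathcal C$ of individual constants and a set $\mathcal P$ of predicate letters, each with a finite arity, among them a binary identity symbol $\approx$; no bound is put on the cardinality of $\mathcal C$ or $\mathcal P$. Terms are the variables $v_0,v_1,\dots$ and the constants. Formulas are built from atomic formulas $P(t_1,\dots,t_n)$ with $\neg,\circ,\bullet$ (unary), $\land,\lor$ (binary), $\forall x,\exists x$; void quantifiers are not allowed: $\forall xA$ and $\exists xA$ are formulas only if $x$ is free in $A$. A sentence is a formula without free variables. $A(t/x)$ is the result of replacing every free occurrence of $x$ in $A$ by $t$. Two formulas are alphabetic variants if they differ at most in their bound variables ($\alpha$-equivalence). *Derivations.* $\Gamma\vdash A$ means that there is a (finite) natural deduction tree of sentences of $\mathcal S$ with conclusion $A$ all of whose undischarged hypotheses belong to $\Gamma$, built with the following rules (premises / conclusion;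 a hypothesis in square brackets is discharged; $A,B,C$ are sentences, except that in the quantifier rules and in $\approx E$ the formula $A$ may have the free variable $x$; $c,c_1,c_2\in\mathcal C$): - $A,\ B\,/\,A\land B$; $\;A\land B\,/\,A$; $\;A\land B\,/\,B$; $\;A\,/\,A\lor B$; $\;B\,/\,A\lor B$; $\;$from $A\lor B$, a derivation of $C$ from $[A]$ and a derivation of $C$ from $[B]$, infer $C$; - $\neg A\,/\,\neg(A\land B)$; $\;\neg B\,/\,\neg(A\land B)$; $\;$from $\neg(A\land B)$, a derivation of $C$ from $[\neg A]$ and a derivation of $C$ from $[\neg B]$, infer $C$; $\;\neg A,\ \neg B\,/\,\neg(A\lor B)$; $\;\neg(A\lor B)\,/\,\neg A$; $\;\neg(A\lor B)\,/\,\neg B$; $\;A\,/\,\neg\neg A$; $\;\neg\neg A\,/\,A$; - $\circ A,\ A,\ \neg A\,/\,B$; $\;\circ A\,/\,A\lor\neg A$; $\;\circ A,\ \bullet A\,/\,B$; $\;$without premises, $\circ A\lor\bullet A$; - ($\forall I$) $B\lor A(c/x)\,/\,B\lor\forall xA$; $\;\forall xA\,/\,A(c/x)$; $\;A(c/x)\,/\,\exists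 xA$; $\;$($\exists E$) from $\exists xA$ and a derivation of $C$ from $[A(c/x)]$, infer $C$; - $\neg A(c/x)\,/\,\neg\forall xA$; $\;$($\neg\forall E$) from $\neg\forall xA$ and a derivation of $C$ from $[\neg A(c/x)]$, infer $C$; $\;$($\neg\exists I$) $\neg A(c/x)\,/\,\neg\exists xA$; $\;\neg\exists xA\,/\,\neg A(c/x)$; - without premises, $c\approx c$; $\;$($\approx E$) $c_1\approx c_2,\ A(c_1/x)\,/\,A(c_2/x)$; $\;A\,/\,A'$ for every alphabetic variant $A'$ of $A$. In $\forall I$, $c$ must not occur in $A$, in $B$, or in any hypothesis on which $B\lor A(c/x)$ depends; in $\neg\exists I$, $c$ must not occur in $A$ or in any hypothesis on which $\neg A(c/x)$ depends; in $\exists E$ (respectively $\neg\forall E$), $c$ must not occur in $A$, in $C$, or in any hypothesis on which the minor premise $C$ depends other than $A(c/x)$ (respectively $\neg A(c/x)$). *Semantics.* An $\mathcal S$-structure $\mathfrak A$ consists of a non-empty domain $D$, an element $c^{\mathfrak A}\in D$ for every $c\in\mathcal C$, and, for every $n$-ary $P\in\mathcal P$, an extension $P_+^{\mathfrak A}\subseteq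 D^n$ and an anti-extension $P_-^{\mathfrak A}\subseteq D^n$, such that $\approx_+^{\mathfrak A}=\{\langle a,a\rangle:a\in D\}$ (nothing else is required of extensions and anti-extensions). The diagram signature $\mathcal S_{\mathfrak A}$ adds to $\mathcal C$ a new constant $\bar a$ for every $a\in D$; $c^{\widehat{\mathfrak A}}$ is $c^{\mathfrak A}$ for $c\in\mathcal C$, and $\bar a^{\widehat{\mathfrak A}}=a$. An $\mathfrak A$-valuation is a map $v$ from the sentences of $\mathcal S_{\mathfrak A}$ to $\{0,1\}$ such that, for all sentences $A,B$, formulas $\forall xA$, $\exists xA$ without free variables, and constants of $\mathcal S_{\mathfrak A}$: 1. $v(P(c_1,\dots,c_n))=1$ iff $\langle c_1^{\widehat{\mathfrak A}},\dots,c_n^{\widehat{\mathfrak A}}\rangle\in P_+^{\mathfrak A}$; 2. $v(\neg P(c_1,\dots,c_n))=1$ iff $\langle c_1^{\widehat{\mathfrak A}},\dots,c_n^{\widehat{\mathfrak A}}\rangle\in P_-^{\mathfrak A}$; 3. $v(A\land B)=1$ iff $v(A)=1$ and $v(B)=1$; 4. $v(A\lor B)=1$ iff $v(A)=1$ or $v(B)=1$;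 5. $v(\neg(A\land B))=1$ iff $v(\neg A)=1$ or $v(\neg B)=1$; 6. $v(\neg(A\lor B))=1$ iff $v(\neg A)=1$ and $v(\neg B)=1$; 7. $v(\neg\neg A)=1$ iff $v(A)=1$; 8. if $v(\circ A)=1$, then $v(A)=1$ iff $v(\neg A)=0$; 9. $v(\circ A)=1$ iff $v(\bullet A)=0$; 10. $v(\forall xA)=1$ iff $v(A(\bar a/x))=1$ for every $a\in D$; 11. $v(\exists xA)=1$ iff $v(A(\bar a/x))=1$ for some $a\in D$; 12. $v(\neg\forall xA)=1$ iff $v(\neg A(\bar a/x))=1$ for some $a\in D$; 13. $v(\neg\exists xA)=1$ iff $v(\neg A(\bar a/x))=1$ for every $a\in D$; 14. $v(A')=v(A)$ if $A'$ is an alphabetic variant of $A$; 15. if no variable other than $x$ is free in the formula $A$ of $\mathcal S_{\mathfrak A}$, $c_1^{\widehat{\mathfrak A}}=c_2^{\widehat{\mathfrak A}}$ and $v(A(c_1/x))=v(A(c_2/x))$, then $v(\#A(c_1/x))=v(\#A(c_2/x))$ for $\#\in\{\neg,\circ,\bullet\}$. $\Gamma\vDash A$ means that $v(A)=1$ for every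 $\mathcal S$-structure $\mathfrak A$ and every $\mathfrak A$-valuation $v$ such that $v(B)=1$ for all $B\in\Gamma$. -/

import Mathlib

universe u

namespace QLETF

/-! Syntax over a type `C` of individual constants and a family `P` of predicate letters
(`P n` is the type of the `n`-ary ones). The individual variables are indexed by `ℕ`. -/

/-- Terms: variables and individual constants. -/
inductive Term (C : Type u) : Type u
  | var (x : ℕ) : Term C
  | const (c : C) : Term C

/-- Raw formulas, in which void quantifiers are still possible. -/
inductive PreForm (C : Type u) (P : ℕ → Type u) : Type u
  | atom {n : ℕ} (p : P n) (t : Fin n → Term C) : PreForm C P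
  | neg (A : PreForm C P) : PreForm C P
  | circ (A : PreForm C P) : PreForm C P
  | bull (A : PreForm C P) : PreForm C P
  | and (A B : PreForm C P) : PreForm C P
  | or (A B : PreForm C P) : PreForm C P
  | all (x : ℕ) (A : PreForm C P) : PreForm C P
  | ex (x : ℕ) (A : PreForm C P) : PreForm C P

/-- `s.subst x t` is `t` if `s` is the variable `x`, and `s` otherwise. -/
def Term.subst {C : Type u} (s : Term C) (x : ℕ) (t : Term C) : Term C :=
  match s with
  | .var y => if y = x then t else .var y
  | .const c => .const c

/-- Renaming of the individual constants of a term. -/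
def Term.map {C C' : Type u} (f : C → C') : Term C → Term C'
  | .var x => .var x
  | .const c => .const (f c)

namespace PreForm

variable {C C' : Type u} {P : ℕ → Type u}

/-- The variables that occur free. -/
def freeVars : PreForm C P → Set ℕ
  | atom _ t => {x | ∃ i, t i = .var x}
  | neg A => A.freeVars
  | circ A => A.freeVars
  | bull A => A.freeVars
  | and A B => A.freeVars ∪ B.freeVars
  | or A B => A.freeVars ∪ B.freeVars
  | all x A => A.freeVars \ {x}
  | ex x A => A.freeVars \ {x}

/-- All variables that occur, whether free, bound or next to a quantifier. -/
def vars : PreForm C P → Set ℕ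
  | atom _ t => {x | ∃ i, t i = .var x}
  | neg A => A.vars
  | circ A => A.vars
  | bull A => A.vars
  | and A B => A.vars ∪ B.vars
  | or A B => A.vars ∪ B.vars
  | all x A => insert x A.vars
  | ex x A => insert x A.vars

/-- The individual constants that occur. -/
def consts : PreForm C P → Set C
  | atom _ t => {c | ∃ i, t i = .const c}
  | neg A => A.consts
  | circ A => A.consts
  | bull A => A.consts
  | and A B => A.consts ∪ B.consts
  | or A B => A.consts ∪ B.consts
  | all _ A => A.consts
  | ex _ A => A.consts

/-- No quantifier is void: `Qx A` is allowed only if `x` is free in `A`. -/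
def NonVoid : PreForm C P → Prop
  | atom _ _ => True
  | neg A => A.NonVoid
  | circ A => A.NonVoid
  | bull A => A.NonVoid
  | and A B => A.NonVoid ∧ B.NonVoid
  | or A B => A.NonVoid ∧ B.NonVoid
  | all x A => x ∈ A.freeVars ∧ A.NonVoid
  | ex x A => x ∈ A.freeVars ∧ A.NonVoid

/-- `A(t/x)`: replace every free occurrence of `x` in `A` by `t`. It is used only where no variable
can be captured, with `t` a constant or a variable that does not occur in `A`. -/
def subst (x : ℕ) (t : Term C) : PreForm C P → PreForm C P
  | atom p s => atom p fun i => (s i).subst x t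
  | neg A => neg (A.subst x t)
  | circ A => circ (A.subst x t)
  | bull A => bull (A.subst x t)
  | and A B => and (A.subst x t) (B.subst x t)
  | or A B => or (A.subst x t) (B.subst x t)
  | all y A => if y = x then all y A else all y (A.subst x t)
  | ex y A => if y = x then ex y A else ex y (A.subst x t)

/-- Renaming of the individual constants of a formula. -/
def map (f : C → C') : PreForm C P → PreForm C' P
  | atom p t => atom p fun i => (t i).map f
  | neg A => neg (A.map f)
  | circ A => circ (A.map f)
  | bull A => bull (A.map f)
  | and A B => and (A.map f) (B.map f)
  | or A B => or (A.map f) (B.map f)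
  | all x A => all x (A.map f)
  | ex x A => ex x (A.map f)

/-- `AlphaEq A B`: `A` and `B` are alphabetic variants, that is, they differ at most in their bound
variables. This is the least congruence that contains the renamings of a bound variable `x` into a
variable `y` that does not occur in the scope. -/
inductive AlphaEq : PreForm C P → PreForm C P → Prop
  | refl (A : PreForm C P) : AlphaEq A A
  | symm {A B : PreForm C P} : AlphaEq A B → AlphaEq B A
  | trans {A B D : PreForm C P} : AlphaEq A B → AlphaEq B D → AlphaEq A D
  | neg {A B : PreForm C P} : AlphaEq A B → AlphaEq (neg A) (neg B)
  | circ {A B : PreForm C P} : AlphaEq A B → AlphaEq (circ A) (circ B)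
  | bull {A B : PreForm C P} : AlphaEq A B → AlphaEq (bull A) (bull B)
  | and {A A' B B' : PreForm C P} :
      AlphaEq A A' → AlphaEq B B' → AlphaEq (and A B) (and A' B')
  | or {A A' B B' : PreForm C P} :
      AlphaEq A A' → AlphaEq B B' → AlphaEq (or A B) (or A' B')
  | all {A B : PreForm C P} (x : ℕ) : AlphaEq A B → AlphaEq (all x A) (all x B)
  | ex {A B : PreForm C P} (x : ℕ) : AlphaEq A B → AlphaEq (ex x A) (ex x B)
  | renameAll (x y : ℕ) (A : PreForm C P) : y ∉ A.vars →
      AlphaEq (PreForm.all x A) (PreForm.all y (A.subst x (.var y)))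
  | renameEx (x y : ℕ) (A : PreForm C P) : y ∉ A.vars →
      AlphaEq (PreForm.ex x A) (PreForm.ex y (A.subst x (.var y)))

theorem freeVars_subst (x : ℕ) (c : C) (A : PreForm C P) :
    (A.subst x (.const c)).freeVars = A.freeVars \ {x} := by
  induction A with
  | atom p t =>
    ext y
    simp only [subst, freeVars, Set.mem_ofPred_eq, Set.mem_sdiff, Set.mem_singleton_iff]
    constructor
    · rintro ⟨i, hi⟩
      cases h : t i with
      | const d => simp [h, Term.subst] at hi
      | var z =>
        by_cases hz : z = x
        · simp [h, Term.subst, hz] at hi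
        · simp only [h, Term.subst, hz, if_false, Term.var.injEq] at hi
          subst hi
          exact ⟨⟨i, h⟩, hz⟩
    · rintro ⟨⟨i, hi⟩, hy⟩
      exact ⟨i, by simp [hi, Term.subst, hy]⟩
  | neg A ih => exact ih
  | circ A ih => exact ih
  | bull A ih => exact ih
  | and A B ihA ihB => simp only [subst, freeVars, ihA, ihB, Set.union_sdiff_distrib]
  | or A B ihA ihB => simp only [subst, freeVars, ihA, ihB, Set.union_sdiff_distrib]
  | all y A ih =>
    by_cases h : y = x
    · simp [subst, freeVars, h]
    · simp only [subst, h, if_false, freeVars, ih]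
      exact Set.sdiff_sdiff_comm
  | ex y A ih =>
    by_cases h : y = x
    · simp [subst, freeVars, h]
    · simp only [subst, h, if_false, freeVars, ih]
      exact Set.sdiff_sdiff_comm

theorem NonVoid.subst (x : ℕ) (c : C) {A : PreForm C P} (hA : A.NonVoid) :
    (A.subst x (.const c)).NonVoid := by
  induction A with
  | atom p t => trivial
  | neg A ih => exact ih hA
  | circ A ih => exact ih hA
  | bull A ih => exact ih hA
  | and A B ihA ihB => exact ⟨ihA hA.1, ihB hA.2⟩
  | or A B ihA ihB => exact ⟨ihA hA.1, ihB hA.2⟩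
  | all y A ih =>
    by_cases h : y = x
    · simpa [PreForm.subst, h] using hA
    · simp only [PreForm.subst, h, if_false, NonVoid, freeVars_subst]
      exact ⟨⟨hA.1, h⟩, ih hA.2⟩
  | ex y A ih =>
    by_cases h : y = x
    · simpa [PreForm.subst, h] using hA
    · simp only [PreForm.subst, h, if_false, NonVoid, freeVars_subst]
      exact ⟨⟨hA.1, h⟩, ih hA.2⟩

theorem freeVars_map (f : C → C') (A : PreForm C P) : (A.map f).freeVars = A.freeVars := by
  induction A with
  | atom p t =>
    ext y
    simp only [map, freeVars, Set.mem_ofPred_eq]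
    refine exists_congr fun i => ?_
    cases t i <;> simp [Term.map]
  | neg A ih => exact ih
  | circ A ih => exact ih
  | bull A ih => exact ih
  | and A B ihA ihB => simp only [map, freeVars, ihA, ihB]
  | or A B ihA ihB => simp only [map, freeVars, ihA, ihB]
  | all y A ih => simp only [map, freeVars, ih]
  | ex y A ih => simp only [map, freeVars, ih]

theorem NonVoid.map (f : C → C') {A : PreForm C P} (hA : A.NonVoid) : (A.map f).NonVoid := by
  induction A with
  | atom p t => trivial
  | neg A ih => exact ih hA
  | circ A ih => exact ih hA
  | bull A ih => exact ih hA
  | and A B ihA ihB => exact ⟨ihA hA.1, ihB hA.2⟩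
  | or A B ihA ihB => exact ⟨ihA hA.1, ihB hA.2⟩
  | all y A ih => exact ⟨by rw [freeVars_map]; exact hA.1, ih hA.2⟩
  | ex y A ih => exact ⟨by rw [freeVars_map]; exact hA.1, ih hA.2⟩

end PreForm

/-- Formulas (without void quantifiers) in which no variable other than `x` is free. -/
def FormIn (C : Type u) (P : ℕ → Type u) (x : ℕ) : Type u :=
  {A : PreForm C P // A.NonVoid ∧ A.freeVars ⊆ {x}}

/-- Sentences: formulas (without void quantifiers) in which no variable is free. -/
def Sentence (C : Type u) (P : ℕ → Type u) : Type u :=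
  {A : PreForm C P // A.NonVoid ∧ A.freeVars = ∅}

/-- The sentence `A(c/x)`. -/
def FormIn.inst {C : Type u} {P : ℕ → Type u} {x : ℕ} (A : FormIn C P x) (c : C) :
    Sentence C P :=
  ⟨A.1.subst x (.const c), A.2.1.subst x c, by
    rw [PreForm.freeVars_subst]; exact Set.sdiff_eq_empty.2 A.2.2⟩

namespace Sentence

variable {C C' : Type u} {P : ℕ → Type u}

/-- The atomic sentence `p(c₁, …, cₙ)`. -/
def atom {n : ℕ} (p : P n) (c : Fin n → C) : Sentence C P :=
  ⟨.atom p fun i => .const (c i), trivial, by simp [PreForm.freeVars]⟩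

def neg (A : Sentence C P) : Sentence C P := ⟨.neg A.1, A.2⟩

def circ (A : Sentence C P) : Sentence C P := ⟨.circ A.1, A.2⟩

def bull (A : Sentence C P) : Sentence C P := ⟨.bull A.1, A.2⟩

def and (A B : Sentence C P) : Sentence C P :=
  ⟨.and A.1 B.1, ⟨A.2.1, B.2.1⟩, by simp [PreForm.freeVars, A.2.2, B.2.2]⟩

def or (A B : Sentence C P) : Sentence C P :=
  ⟨.or A.1 B.1, ⟨A.2.1, B.2.1⟩, by simp [PreForm.freeVars, A.2.2, B.2.2]⟩

/-- The sentence `∀x A`, where `x` is the only variable that is free in `A`. -/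
def all {x : ℕ} (A : FormIn C P x) (hx : x ∈ A.1.freeVars) : Sentence C P :=
  ⟨.all x A.1, ⟨hx, A.2.1⟩, Set.sdiff_eq_empty.2 A.2.2⟩

/-- The sentence `∃x A`, where `x` is the only variable that is free in `A`. -/
def ex {x : ℕ} (A : FormIn C P x) (hx : x ∈ A.1.freeVars) : Sentence C P :=
  ⟨.ex x A.1, ⟨hx, A.2.1⟩, Set.sdiff_eq_empty.2 A.2.2⟩

/-- Renaming of the individual constants of a sentence. -/
def map (f : C → C') (A : Sentence C P) : Sentence C' P :=
  ⟨A.1.map f, A.2.1.map f, by rw [PreForm.freeVars_map]; exact A.2.2⟩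

end Sentence

/-- A signature: an infinite set of individual constants and a set of predicate letters with finite
arities, one of which, of arity two, is the identity symbol. -/
structure Signature : Type (u + 1) where
  Const : Type u
  Pred : ℕ → Type u
  eqSym : Pred 2
  infinite_const : Infinite Const

namespace Signature

/-- The sentences of the language of a signature. -/
abbrev Sent (S : Signature.{u}) : Type u := Sentence S.Const S.Pred

/-- The formulas of the language of a signature in which no variable other than `x` is free. -/
abbrev FormIn (S : Signature.{u}) (x : ℕ) : Type u := QLETF.FormIn S.Const S.Pred x

/-- The sentence that says that `c₁` and `c₂` are identical. -/
def eqSent (S : Signature.{u}) (c₁ c₂ : S.Const) : S.Sent := Sentence.atom S.eqSym ![c₁, c₂]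

/-- `S.Deriv Γ A`: there is a natural deduction tree with conclusion `A` whose set of undischarged
hypotheses (the hypotheses on which `A` depends) is `Γ`. -/
inductive Deriv (S : Signature.{u}) : Set S.Sent → S.Sent → Prop
  | hyp (A : S.Sent) : Deriv S {A} A
  | andI {Γ Δ : Set S.Sent} {A B : S.Sent} :
      Deriv S Γ A → Deriv S Δ B → Deriv S (Γ ∪ Δ) (A.and B)
  | andE₁ {Γ : Set S.Sent} {A B : S.Sent} : Deriv S Γ (A.and B) → Deriv S Γ A
  | andE₂ {Γ : Set S.Sent} {A B : S.Sent} : Deriv S Γ (A.and B) → Deriv S Γ B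
  | orI₁ {Γ : Set S.Sent} {A : S.Sent} (B : S.Sent) : Deriv S Γ A → Deriv S Γ (A.or B)
  | orI₂ {Γ : Set S.Sent} (A : S.Sent) {B : S.Sent} : Deriv S Γ B → Deriv S Γ (A.or B)
  | orE {Γ Δ Θ : Set S.Sent} {A B D : S.Sent} :
      Deriv S Γ (A.or B) → Deriv S Δ D → Deriv S Θ D →
      Deriv S (Γ ∪ (Δ \ {A}) ∪ (Θ \ {B})) D
  | negAndI₁ {Γ : Set S.Sent} {A : S.Sent} (B : S.Sent) :
      Deriv S Γ A.neg → Deriv S Γ (A.and B).neg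
  | negAndI₂ {Γ : Set S.Sent} (A : S.Sent) {B : S.Sent} :
      Deriv S Γ B.neg → Deriv S Γ (A.and B).neg
  | negAndE {Γ Δ Θ : Set S.Sent} {A B D : S.Sent} :
      Deriv S Γ (A.and B).neg → Deriv S Δ D → Deriv S Θ D →
      Deriv S (Γ ∪ (Δ \ {A.neg}) ∪ (Θ \ {B.neg})) D
  | negOrI {Γ Δ : Set S.Sent} {A B : S.Sent} :
      Deriv S Γ A.neg → Deriv S Δ B.neg → Deriv S (Γ ∪ Δ) (A.or B).neg
  | negOrE₁ {Γ : Set S.Sent} {A B : S.Sent} : Deriv S Γ (A.or B).neg → Deriv S Γ A.neg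
  | negOrE₂ {Γ : Set S.Sent} {A B : S.Sent} : Deriv S Γ (A.or B).neg → Deriv S Γ B.neg
  | dnI {Γ : Set S.Sent} {A : S.Sent} : Deriv S Γ A → Deriv S Γ A.neg.neg
  | dnE {Γ : Set S.Sent} {A : S.Sent} : Deriv S Γ A.neg.neg → Deriv S Γ A
  | expCirc {Γ Δ Θ : Set S.Sent} {A : S.Sent} (B : S.Sent) :
      Deriv S Γ A.circ → Deriv S Δ A → Deriv S Θ A.neg → Deriv S (Γ ∪ Δ ∪ Θ) B
  | pemCirc {Γ : Set S.Sent} {A : S.Sent} : Deriv S Γ A.circ → Deriv S Γ (A.or A.neg)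
  | cons {Γ Δ : Set S.Sent} {A : S.Sent} (B : S.Sent) :
      Deriv S Γ A.circ → Deriv S Δ A.bull → Deriv S (Γ ∪ Δ) B
  | comp (A : S.Sent) : Deriv S ∅ (A.circ.or A.bull)
  | allI {Γ : Set S.Sent} {B : S.Sent} {x : ℕ} {A : S.FormIn x} (hx : x ∈ A.1.freeVars)
      {c : S.Const} :
      Deriv S Γ (B.or (A.inst c)) → c ∉ A.1.consts → c ∉ B.1.consts →
      (∀ H ∈ Γ, c ∉ H.1.consts) → Deriv S Γ (B.or (Sentence.all A hx))
  | allE {Γ : Set S.Sent} {x : ℕ} {A : S.FormIn x} {hx : x ∈ A.1.freeVars} (c : S.Const) :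
      Deriv S Γ (Sentence.all A hx) → Deriv S Γ (A.inst c)
  | exI {Γ : Set S.Sent} {x : ℕ} {A : S.FormIn x} (hx : x ∈ A.1.freeVars) {c : S.Const} :
      Deriv S Γ (A.inst c) → Deriv S Γ (Sentence.ex A hx)
  | exE {Γ Δ : Set S.Sent} {x : ℕ} {A : S.FormIn x} {hx : x ∈ A.1.freeVars} {D : S.Sent}
      {c : S.Const} :
      Deriv S Γ (Sentence.ex A hx) → Deriv S Δ D → c ∉ A.1.consts → c ∉ D.1.consts →
      (∀ H ∈ Δ, H ≠ A.inst c → c ∉ H.1.consts) → Deriv S (Γ ∪ (Δ \ {A.inst c})) D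
  | negAllI {Γ : Set S.Sent} {x : ℕ} {A : S.FormIn x} (hx : x ∈ A.1.freeVars) {c : S.Const} :
      Deriv S Γ (A.inst c).neg → Deriv S Γ (Sentence.all A hx).neg
  | negAllE {Γ Δ : Set S.Sent} {x : ℕ} {A : S.FormIn x} {hx : x ∈ A.1.freeVars} {D : S.Sent}
      {c : S.Const} :
      Deriv S Γ (Sentence.all A hx).neg → Deriv S Δ D → c ∉ A.1.consts → c ∉ D.1.consts →
      (∀ H ∈ Δ, H ≠ (A.inst c).neg → c ∉ H.1.consts) →
      Deriv S (Γ ∪ (Δ \ {(A.inst c).neg})) D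
  | negExI {Γ : Set S.Sent} {x : ℕ} {A : S.FormIn x} (hx : x ∈ A.1.freeVars) {c : S.Const} :
      Deriv S Γ (A.inst c).neg → c ∉ A.1.consts → (∀ H ∈ Γ, c ∉ H.1.consts) →
      Deriv S Γ (Sentence.ex A hx).neg
  | negExE {Γ : Set S.Sent} {x : ℕ} {A : S.FormIn x} {hx : x ∈ A.1.freeVars} (c : S.Const) :
      Deriv S Γ (Sentence.ex A hx).neg → Deriv S Γ (A.inst c).neg
  | eqI (c : S.Const) : Deriv S ∅ (S.eqSent c c)
  | eqE {Γ Δ : Set S.Sent} {c₁ c₂ : S.Const} {x : ℕ} (A : S.FormIn x) :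
      Deriv S Γ (S.eqSent c₁ c₂) → Deriv S Δ (A.inst c₁) → Deriv S (Γ ∪ Δ) (A.inst c₂)
  | av {Γ : Set S.Sent} {A A' : S.Sent} :
      Deriv S Γ A → PreForm.AlphaEq A.1 A'.1 → Deriv S Γ A'

/-- `Γ ⊢ A`: there is a derivation of `A` all of whose undischarged hypotheses are in `Γ`. -/
def Proves (S : Signature.{u}) (Γ : Set S.Sent) (A : S.Sent) : Prop :=
  ∃ Γ₀ ⊆ Γ, S.Deriv Γ₀ A

/-- A structure: a non-empty domain, an element of it for every constant, and an extension and an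
anti-extension for every predicate letter; the extension of the identity symbol is the diagonal. -/
structure Struc (S : Signature.{u}) : Type (u + 1) where
  Dom : Type u
  nonempty_dom : Nonempty Dom
  con : S.Const → Dom
  ext {n : ℕ} (p : S.Pred n) : Set (Fin n → Dom)
  antiExt {n : ℕ} (p : S.Pred n) : Set (Fin n → Dom)
  ext_eqSym : ext S.eqSym = {d | ∃ a, d = ![a, a]}

namespace Struc

variable {S : Signature.{u}}

/-- The diagram signature: a new constant is added for every element of the domain. -/
def diagram (M : S.Struc) : Signature.{u} where
  Const := S.Const ⊕ M.Dom
  Pred := S.Pred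
  eqSym := S.eqSym
  infinite_const := have := S.infinite_const; inferInstance

/-- The new constant for the element `a` of the domain. -/
def name (M : S.Struc) (a : M.Dom) : M.diagram.Const := Sum.inr a

/-- The expansion of `M` to the diagram signature, where the new constant for `a` denotes `a`. -/
def hat (M : S.Struc) : M.diagram.Struc where
  Dom := M.Dom
  nonempty_dom := M.nonempty_dom
  con := Sum.elim M.con id
  ext := M.ext
  antiExt := M.antiExt
  ext_eqSym := M.ext_eqSym

/-- The inclusion of the sentences of `S` in those of the diagram signature. -/
def incl (M : S.Struc) (A : S.Sent) : M.diagram.Sent := Sentence.map Sum.inl A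

/-- `v` is an `M`-valuation; `true` and `false` stand for `1` and `0`. -/
structure IsValuation (M : S.Struc) (v : M.diagram.Sent → Bool) : Prop where
  atom {n : ℕ} (p : S.Pred n) (c : Fin n → M.diagram.Const) :
    v (Sentence.atom p c) = true ↔ (fun i => M.hat.con (c i)) ∈ M.ext p
  negAtom {n : ℕ} (p : S.Pred n) (c : Fin n → M.diagram.Const) :
    v (Sentence.atom p c).neg = true ↔ (fun i => M.hat.con (c i)) ∈ M.antiExt p
  and (A B : M.diagram.Sent) : v (A.and B) = true ↔ v A = true ∧ v B = true
  or (A B : M.diagram.Sent) : v (A.or B) = true ↔ v A = true ∨ v B = true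
  negAnd (A B : M.diagram.Sent) : v (A.and B).neg = true ↔ v A.neg = true ∨ v B.neg = true
  negOr (A B : M.diagram.Sent) : v (A.or B).neg = true ↔ v A.neg = true ∧ v B.neg = true
  negNeg (A : M.diagram.Sent) : v A.neg.neg = true ↔ v A = true
  circ (A : M.diagram.Sent) : v A.circ = true → (v A = true ↔ v A.neg = false)
  circBull (A : M.diagram.Sent) : v A.circ = true ↔ v A.bull = false
  all {x : ℕ} (A : M.diagram.FormIn x) (hx : x ∈ A.1.freeVars) :
    v (Sentence.all A hx) = true ↔ ∀ a : M.Dom, v (A.inst (M.name a)) = true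
  ex {x : ℕ} (A : M.diagram.FormIn x) (hx : x ∈ A.1.freeVars) :
    v (Sentence.ex A hx) = true ↔ ∃ a : M.Dom, v (A.inst (M.name a)) = true
  negAll {x : ℕ} (A : M.diagram.FormIn x) (hx : x ∈ A.1.freeVars) :
    v (Sentence.all A hx).neg = true ↔ ∃ a : M.Dom, v (A.inst (M.name a)).neg = true
  negEx {x : ℕ} (A : M.diagram.FormIn x) (hx : x ∈ A.1.freeVars) :
    v (Sentence.ex A hx).neg = true ↔ ∀ a : M.Dom, v (A.inst (M.name a)).neg = true
  alpha (A A' : M.diagram.Sent) : PreForm.AlphaEq A.1 A'.1 → v A' = v A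
  congr {x : ℕ} (A : M.diagram.FormIn x) (c₁ c₂ : M.diagram.Const) :
    M.hat.con c₁ = M.hat.con c₂ → v (A.inst c₁) = v (A.inst c₂) →
      v (A.inst c₁).neg = v (A.inst c₂).neg ∧ v (A.inst c₁).circ = v (A.inst c₂).circ ∧
        v (A.inst c₁).bull = v (A.inst c₂).bull

end Struc

/-- `Γ ⊨ A`: `A` holds in every interpretation `⟨M, v⟩` in which all elements of `Γ` hold. -/
def Entails (S : Signature.{u}) (Γ : Set S.Sent) (A : S.Sent) : Prop :=
  ∀ (M : S.Struc) (v : M.diagram.Sent → Bool), M.IsValuation v →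
    (∀ B ∈ Γ, v (M.incl B) = true) → v (M.incl A) = true

end Signature

end QLETF

namespace QLETF

/-! The proof is a Henkin construction, by contraposition. A valuation is not determined by its
structure, so no truth lemma by induction on formulas is needed: it suffices to find a prime theory
with witnesses that omits the unprovable sentence, to take the constants modulo provable identity as
the domain, and to call a sentence true when it lies in the theory. Each clause for valuations then
follows from the matching rules. In particular, `≈E` applied to `¬A`, `∘A` and `•A` gives the
substitution clause.

The difficulty is the witnesses. For `∃` the theory needs `∃xA ⟹ A(c/x)`, and for `∀` it needs
`A(c/x) ⟹ ∀xA`. There is no implication with which to write these conditions as axioms. Instead a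
pair of a theory `T` and a sentence `D` with `T ⊬ D` is enlarged: a condition is met either by
adding its right side to `T` or by adding its left side to `D` as a disjunct. The form of `∀I` with
a side disjunct makes one of the two possible when `c` is fresh (`proves_of_fresh`). Since `D`
remains a sentence, only finitely many conditions can be met in this way (`exists_decided`). A prime
theory is built for each finite set of conditions, and an ultrafilter limit of these theories meets
all conditions at once, in any cardinality (`exists_isHenkin`).

Every quantified sentence has its own witness, a constant generated together with the formulas.
Well-foundedness of this generation supplies the freshness. Passing to the larger language is
harmless because derivations survive every renaming of constants (`Proves.map_of_deriv`,
`Proves.of_map`). -/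

theorem Term.map_subst {C C' : Type u} (f : C → C') (s : Term C) (x : ℕ) (t : Term C) :
    (s.subst x t).map f = (s.map f).subst x (t.map f) := by
  cases s with
  | var y => by_cases h : y = x <;> simp [Term.subst, Term.map, h]
  | const c => rfl

/-! ### Renaming of constants in formulas -/

namespace PreForm

variable {C C' C'' : Type u} {P : ℕ → Type u}

theorem map_subst (f : C → C') (x : ℕ) (t : Term C) (A : PreForm C P) :
    (A.subst x t).map f = (A.map f).subst x (t.map f) := by
  induction A with
  | atom p s => simp only [subst, map, Term.map_subst]
  | neg A ih | circ A ih | bull A ih => simp only [subst, map, ih]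
  | and A B ihA ihB | or A B ihA ihB => simp only [subst, map, ihA, ihB]
  | all y A ih | ex y A ih => by_cases h : y = x <;> simp [subst, map, h, ih]

theorem vars_map (f : C → C') (A : PreForm C P) : (A.map f).vars = A.vars := by
  induction A with
  | atom p t =>
    ext y
    simp only [map, vars, Set.mem_ofPred_eq]
    refine exists_congr fun i => ?_
    cases t i <;> simp [Term.map]
  | neg A ih | circ A ih | bull A ih => exact ih
  | and A B ihA ihB | or A B ihA ihB => simp only [map, vars, ihA, ihB]
  | all y A ih | ex y A ih => simp only [map, vars, ih]

theorem consts_map_subset (f : C → C') (A : PreForm C P) :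
    (A.map f).consts ⊆ f '' A.consts := by
  induction A with
  | atom p t =>
    rintro c ⟨i, hi⟩
    cases h : t i with
    | var z => simp [h, Term.map] at hi
    | const d =>
      simp only [h, Term.map, Term.const.injEq] at hi
      exact ⟨d, ⟨i, h⟩, hi⟩
  | neg A ih | circ A ih | bull A ih => exact ih
  | and A B ihA ihB | or A B ihA ihB =>
    simp only [map, consts, Set.image_union]
    exact Set.union_subset_union ihA ihB
  | all y A ih | ex y A ih => exact ih

theorem consts_subst_subset (x : ℕ) (c : C) (A : PreForm C P) :
    (A.subst x (.const c)).consts ⊆ insert c A.consts := by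
  induction A with
  | atom p t =>
    rintro d ⟨i, hi⟩
    cases h : t i with
    | var z =>
      by_cases hz : z = x
      · simp only [h, Term.subst, hz, if_true, Term.const.injEq] at hi
        exact Or.inl hi.symm
      · simp [h, Term.subst, hz] at hi
    | const e =>
      simp only [h, Term.subst, Term.const.injEq] at hi
      exact Or.inr ⟨i, by rw [h, hi]⟩
  | neg A ih | circ A ih | bull A ih => exact ih
  | and A B ihA ihB | or A B ihA ihB =>
    simp only [subst, consts, Set.insert_union_distrib]
    exact Set.union_subset_union ihA ihB
  | all y A ih | ex y A ih =>
    by_cases h : y = x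
    · simp [subst, h, consts]
    · simpa [subst, h, consts] using ih

theorem finite_consts (A : PreForm C P) : A.consts.Finite := by
  induction A with
  | atom p t =>
    refine ((Set.finite_range t).preimage (f := Term.const) ?_).subset ?_
    · exact fun _ _ _ _ h => Term.const.inj h
    · rintro c ⟨i, hi⟩
      exact ⟨i, hi⟩
  | neg A ih | circ A ih | bull A ih | all y A ih | ex y A ih => exact ih
  | and A B ihA ihB | or A B ihA ihB => exact ihA.union ihB

theorem map_congr {f g : C → C'} {A : PreForm C P} (h : ∀ c ∈ A.consts, f c = g c) :
    A.map f = A.map g := by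
  induction A with
  | atom p t =>
    simp only [map, atom.injEq, heq_eq_eq, true_and]
    funext i
    cases hi : t i with
    | var x => rfl
    | const c => simp [Term.map, h c ⟨i, hi⟩]
  | neg A ih | circ A ih | bull A ih | all y A ih | ex y A ih => simp only [map, ih h]
  | and A B ihA ihB | or A B ihA ihB =>
    simp only [map, ihA fun c hc => h c (Or.inl hc), ihB fun c hc => h c (Or.inr hc)]

theorem map_map (f : C → C') (g : C' → C'') (A : PreForm C P) :
    (A.map f).map g = A.map (g ∘ f) := by
  induction A with
  | atom p t =>
    simp only [map, atom.injEq, heq_eq_eq, true_and]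
    funext i
    cases t i <;> rfl
  | neg A ih | circ A ih | bull A ih | all y A ih | ex y A ih => simp only [map, ih]
  | and A B ihA ihB | or A B ihA ihB => simp only [map, ihA, ihB]

theorem map_id (A : PreForm C P) : A.map id = A := by
  induction A with
  | atom p t =>
    simp only [map, atom.injEq, heq_eq_eq, true_and]
    funext i
    cases t i <;> rfl
  | neg A ih | circ A ih | bull A ih | all y A ih | ex y A ih => simp only [map, ih]
  | and A B ihA ihB | or A B ihA ihB => simp only [map, ihA, ihB]

theorem AlphaEq.map (f : C → C') {A B : PreForm C P} (h : AlphaEq A B) :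
    AlphaEq (A.map f) (B.map f) := by
  induction h with
  | refl A => exact .refl _
  | symm _ ih => exact ih.symm
  | trans _ _ ih₁ ih₂ => exact ih₁.trans ih₂
  | neg _ ih => exact ih.neg
  | circ _ ih => exact ih.circ
  | bull _ ih => exact ih.bull
  | and _ _ ih₁ ih₂ => exact ih₁.and ih₂
  | or _ _ ih₁ ih₂ => exact ih₁.or ih₂
  | all x _ ih => exact ih.all x
  | ex x _ ih => exact ih.ex x
  | renameAll x y A hy =>
    simp only [PreForm.map, map_subst]
    exact .renameAll x y _ (by rwa [vars_map])
  | renameEx x y A hy =>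
    simp only [PreForm.map, map_subst]
    exact .renameEx x y _ (by rwa [vars_map])

end PreForm

namespace FormIn

variable {C C' : Type u} {P : ℕ → Type u} {x : ℕ}

/-- Renaming of the individual constants of a formula in which only `x` may be free. -/
def map (f : C → C') (A : FormIn C P x) : FormIn C' P x :=
  ⟨A.1.map f, A.2.1.map f, by rw [PreForm.freeVars_map]; exact A.2.2⟩

/-- The negation of a formula in which only `x` may be free. -/
def neg (A : FormIn C P x) : FormIn C P x := ⟨.neg A.1, A.2⟩

/-- The consistency of a formula in which only `x` may be free. -/
def circ (A : FormIn C P x) : FormIn C P x := ⟨.circ A.1, A.2⟩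

/-- The inconsistency of a formula in which only `x` may be free. -/
def bull (A : FormIn C P x) : FormIn C P x := ⟨.bull A.1, A.2⟩

theorem map_inst (f : C → C') (A : FormIn C P x) (c : C) :
    (A.inst c).map f = (A.map f).inst (f c) :=
  Subtype.ext (PreForm.map_subst f x (.const c) A.1)

theorem map_congr {f g : C → C'} {A : FormIn C P x} (h : ∀ c ∈ A.1.consts, f c = g c) :
    A.map f = A.map g :=
  Subtype.ext (PreForm.map_congr h)

theorem mem_freeVars_map (f : C → C') {A : FormIn C P x} (hx : x ∈ A.1.freeVars) :
    x ∈ (A.map f).1.freeVars := by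
  simpa [map, PreForm.freeVars_map] using hx

/-- The formula `p(c₁, …, v₀, …, cₙ)` with the variable `v₀` at place `i`. -/
def atomHole {n : ℕ} (p : P n) (c : Fin n → C)
    (i : Fin n) : FormIn C P 0 :=
  ⟨.atom p (Function.update (fun j => .const (c j)) i (.var 0)), trivial, by
    rintro y ⟨j, hj⟩
    by_cases h : j = i
    · subst h
      simpa using hj.symm
    · simp [h] at hj⟩

theorem inst_atomHole {n : ℕ} (p : P n)
    (c : Fin n → C) (i : Fin n) (d : C) :
    (atomHole p c i).inst d = Sentence.atom p (Function.update c i d) := by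
  refine Subtype.ext ?_
  simp only [inst, atomHole, PreForm.subst, Sentence.atom, PreForm.atom.injEq,
    heq_eq_eq, true_and]
  funext j
  by_cases h : j = i
  · subst h
    simp [Term.subst]
  · simp [h, Term.subst]

end FormIn

namespace Sentence

variable {C C' : Type u} {P : ℕ → Type u}

theorem map_congr {f g : C → C'} {A : Sentence C P} (h : ∀ c ∈ A.1.consts, f c = g c) :
    A.map f = A.map g :=
  Subtype.ext (PreForm.map_congr h)

end Sentence

/-! ### Henkin constants and their rank -/

/-- Individual constants obtained from those in `C` by adding a witness for every formula that is
built with the constants themselves. -/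
inductive HenkinConst (C : Type u) (P : ℕ → Type u) : Type u
  | base (c : C) : HenkinConst C P
  | wit (A : PreForm (HenkinConst C P) P) : HenkinConst C P

namespace HenkinConst

variable {C : Type u} {P : ℕ → Type u}

/-- `c` occurs in the formula that `d` is a witness for. -/
def OccursIn (c d : HenkinConst C P) : Prop := ∃ A, d = wit A ∧ c ∈ A.consts

/-- The formula inside `wit A` is generated before `wit A` itself, so structural induction applies.
The recursor of the nested type is used directly, and its motive for formulas says that all
constants occurring in them are accessible. -/
theorem acc_occursIn (c : HenkinConst C P) : Acc OccursIn c := by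
  refine HenkinConst.rec (motive_1 := fun c => Acc OccursIn c)
    (motive_2 := fun A => ∀ c ∈ A.consts, Acc OccursIn c)
    (motive_3 := fun t => ∀ c, t = .const c → Acc OccursIn c)
    ?_ ?_ ?_ ?_ ?_ ?_ ?_ ?_ ?_ ?_ ?_ ?_ c
  · rintro c
    exact ⟨_, by rintro d ⟨A, h, -⟩; cases h⟩
  · intro A ih
    exact ⟨_, by rintro d ⟨B, h, hd⟩; cases h; exact ih d hd⟩
  · rintro n p t ih c ⟨i, hi⟩
    exact ih i c hi
  · exact fun A ih => ih
  · exact fun A ih => ih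
  · exact fun A ih => ih
  · exact fun A B ihA ihB c hc => hc.elim (ihA c) (ihB c)
  · exact fun A B ihA ihB c hc => hc.elim (ihA c) (ihB c)
  · exact fun x A ih => ih
  · exact fun x A ih => ih
  · intro x c h
    cases h
  · intro c ih d h
    cases h
    exact ih

/-- The rank of a constant in the well-founded relation `OccursIn`. -/
noncomputable def rank (c : HenkinConst C P) : Ordinal.{u} := (acc_occursIn c).rank

theorem rank_lt {c : HenkinConst C P} {A : PreForm (HenkinConst C P) P} (h : c ∈ A.consts) :
    c.rank < (wit A).rank :=
  Acc.rank_lt_of_rel (acc_occursIn (wit A)) ⟨A, rfl, h⟩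

theorem wit_notMem (A : PreForm (HenkinConst C P) P) : wit A ∉ A.consts :=
  fun h => (rank_lt h).false

end HenkinConst

/-! ### Finiteness of derivations and rules for provability -/

namespace Signature

variable {S : Signature.{u}}

/-- Finiteness provides fresh constants for renamed derivations, upper bounds of chains in Zorn's
lemma, and closure of ultrafilter limits under provability. -/
theorem Deriv.finite {Γ : Set S.Sent} {A : S.Sent} (h : S.Deriv Γ A) : Γ.Finite := by
  induction h <;> simp_all [Set.Finite.sdiff]

namespace Proves

variable {Γ Δ : Set S.Sent} {A B D : S.Sent}

theorem mono (h : S.Proves Γ A) (hΓ : Γ ⊆ Δ) : S.Proves Δ A :=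
  let ⟨Γ₀, h₀, hd⟩ := h
  ⟨Γ₀, h₀.trans hΓ, hd⟩

theorem hyp (h : A ∈ Γ) : S.Proves Γ A := ⟨{A}, Set.singleton_subset_iff.2 h, .hyp A⟩

theorem andI : S.Proves Γ A → S.Proves Γ B → S.Proves Γ (A.and B)
  | ⟨_, h₁, d₁⟩, ⟨_, h₂, d₂⟩ => ⟨_, Set.union_subset h₁ h₂, .andI d₁ d₂⟩

theorem andE₁ : S.Proves Γ (A.and B) → S.Proves Γ A
  | ⟨_, h, d⟩ => ⟨_, h, .andE₁ d⟩

theorem andE₂ : S.Proves Γ (A.and B) → S.Proves Γ B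
  | ⟨_, h, d⟩ => ⟨_, h, .andE₂ d⟩

theorem orI₁ (B : S.Sent) : S.Proves Γ A → S.Proves Γ (A.or B)
  | ⟨_, h, d⟩ => ⟨_, h, .orI₁ B d⟩

theorem orI₂ (A : S.Sent) : S.Proves Γ B → S.Proves Γ (A.or B)
  | ⟨_, h, d⟩ => ⟨_, h, .orI₂ A d⟩

theorem orE : S.Proves Γ (A.or B) → S.Proves (insert A Γ) D → S.Proves (insert B Γ) D →
    S.Proves Γ D
  | ⟨_, h, d⟩, ⟨_, h₁, d₁⟩, ⟨_, h₂, d₂⟩ =>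
    ⟨_, Set.union_subset (Set.union_subset h (Set.sdiff_singleton_subset_iff.2 h₁))
      (Set.sdiff_singleton_subset_iff.2 h₂), .orE d d₁ d₂⟩

/-- In the absence of an implication, this is `∨E` applied to `A ∨ A` with the same minor premise
twice. -/
theorem cut (h : S.Proves Γ A) (h' : S.Proves (insert A Γ) B) : S.Proves Γ B :=
  orE (h.orI₁ A) h' h'

theorem negAndI₁ (B : S.Sent) : S.Proves Γ A.neg → S.Proves Γ (A.and B).neg
  | ⟨_, h, d⟩ => ⟨_, h, .negAndI₁ B d⟩

theorem negAndI₂ (A : S.Sent) : S.Proves Γ B.neg → S.Proves Γ (A.and B).neg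
  | ⟨_, h, d⟩ => ⟨_, h, .negAndI₂ A d⟩

theorem negAndE : S.Proves Γ (A.and B).neg → S.Proves (insert A.neg Γ) D →
    S.Proves (insert B.neg Γ) D → S.Proves Γ D
  | ⟨_, h, d⟩, ⟨_, h₁, d₁⟩, ⟨_, h₂, d₂⟩ =>
    ⟨_, Set.union_subset (Set.union_subset h (Set.sdiff_singleton_subset_iff.2 h₁))
      (Set.sdiff_singleton_subset_iff.2 h₂), .negAndE d d₁ d₂⟩

theorem negOrI : S.Proves Γ A.neg → S.Proves Γ B.neg → S.Proves Γ (A.or B).neg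
  | ⟨_, h₁, d₁⟩, ⟨_, h₂, d₂⟩ => ⟨_, Set.union_subset h₁ h₂, .negOrI d₁ d₂⟩

theorem negOrE₁ : S.Proves Γ (A.or B).neg → S.Proves Γ A.neg
  | ⟨_, h, d⟩ => ⟨_, h, .negOrE₁ d⟩

theorem negOrE₂ : S.Proves Γ (A.or B).neg → S.Proves Γ B.neg
  | ⟨_, h, d⟩ => ⟨_, h, .negOrE₂ d⟩

theorem dnI : S.Proves Γ A → S.Proves Γ A.neg.neg
  | ⟨_, h, d⟩ => ⟨_, h, .dnI d⟩

theorem dnE : S.Proves Γ A.neg.neg → S.Proves Γ A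
  | ⟨_, h, d⟩ => ⟨_, h, .dnE d⟩

theorem expCirc (B : S.Sent) : S.Proves Γ A.circ → S.Proves Γ A → S.Proves Γ A.neg →
    S.Proves Γ B
  | ⟨_, h₁, d₁⟩, ⟨_, h₂, d₂⟩, ⟨_, h₃, d₃⟩ =>
    ⟨_, Set.union_subset (Set.union_subset h₁ h₂) h₃, .expCirc B d₁ d₂ d₃⟩

theorem pemCirc : S.Proves Γ A.circ → S.Proves Γ (A.or A.neg)
  | ⟨_, h, d⟩ => ⟨_, h, .pemCirc d⟩

theorem cons (B : S.Sent) : S.Proves Γ A.circ → S.Proves Γ A.bull → S.Proves Γ B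
  | ⟨_, h₁, d₁⟩, ⟨_, h₂, d₂⟩ => ⟨_, Set.union_subset h₁ h₂, .cons B d₁ d₂⟩

theorem comp (A : S.Sent) : S.Proves Γ (A.circ.or A.bull) := ⟨_, Set.empty_subset _, .comp A⟩

section Quantifiers

variable {x : ℕ} {F : S.FormIn x}

theorem allI (hx : x ∈ F.1.freeVars) {c : S.Const} (h : S.Proves Γ (B.or (F.inst c)))
    (hF : c ∉ F.1.consts) (hB : c ∉ B.1.consts) (hΓ : ∀ H ∈ Γ, c ∉ H.1.consts) :
    S.Proves Γ (B.or (Sentence.all F hx)) :=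
  let ⟨Γ₀, h₀, d⟩ := h
  ⟨Γ₀, h₀, .allI hx d hF hB fun H hH => hΓ H (h₀ hH)⟩

theorem allE {hx : x ∈ F.1.freeVars} (c : S.Const) :
    S.Proves Γ (Sentence.all F hx) → S.Proves Γ (F.inst c)
  | ⟨_, h, d⟩ => ⟨_, h, .allE c d⟩

theorem exI (hx : x ∈ F.1.freeVars) {c : S.Const} :
    S.Proves Γ (F.inst c) → S.Proves Γ (Sentence.ex F hx)
  | ⟨_, h, d⟩ => ⟨_, h, .exI hx d⟩

theorem exE {hx : x ∈ F.1.freeVars} {c : S.Const} (h : S.Proves Γ (Sentence.ex F hx))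
    (h' : S.Proves (insert (F.inst c) Γ) D) (hF : c ∉ F.1.consts) (hD : c ∉ D.1.consts)
    (hΓ : ∀ H ∈ Γ, c ∉ H.1.consts) : S.Proves Γ D :=
  let ⟨_, h₀, d⟩ := h
  let ⟨_, h₁, d₁⟩ := h'
  ⟨_, Set.union_subset h₀ (Set.sdiff_singleton_subset_iff.2 h₁),
    .exE d d₁ hF hD fun H hH hne => hΓ H ((h₁ hH).resolve_left hne)⟩

theorem negAllI (hx : x ∈ F.1.freeVars) {c : S.Const} :
    S.Proves Γ (F.inst c).neg → S.Proves Γ (Sentence.all F hx).neg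
  | ⟨_, h, d⟩ => ⟨_, h, .negAllI hx d⟩

theorem negAllE {hx : x ∈ F.1.freeVars} {c : S.Const}
    (h : S.Proves Γ (Sentence.all F hx).neg)
    (h' : S.Proves (insert (F.inst c).neg Γ) D) (hF : c ∉ F.1.consts) (hD : c ∉ D.1.consts)
    (hΓ : ∀ H ∈ Γ, c ∉ H.1.consts) : S.Proves Γ D :=
  let ⟨_, h₀, d⟩ := h
  let ⟨_, h₁, d₁⟩ := h'
  ⟨_, Set.union_subset h₀ (Set.sdiff_singleton_subset_iff.2 h₁),
    .negAllE d d₁ hF hD fun H hH hne => hΓ H ((h₁ hH).resolve_left hne)⟩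

theorem negExI (hx : x ∈ F.1.freeVars) {c : S.Const} (h : S.Proves Γ (F.inst c).neg)
    (hF : c ∉ F.1.consts) (hΓ : ∀ H ∈ Γ, c ∉ H.1.consts) :
    S.Proves Γ (Sentence.ex F hx).neg :=
  let ⟨Γ₀, h₀, d⟩ := h
  ⟨Γ₀, h₀, .negExI hx d hF fun H hH => hΓ H (h₀ hH)⟩

theorem negExE {hx : x ∈ F.1.freeVars} (c : S.Const) :
    S.Proves Γ (Sentence.ex F hx).neg → S.Proves Γ (F.inst c).neg
  | ⟨_, h, d⟩ => ⟨_, h, .negExE c d⟩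

theorem eqI (c : S.Const) : S.Proves Γ (S.eqSent c c) := ⟨_, Set.empty_subset _, .eqI c⟩

theorem eqE (F : S.FormIn x) {c₁ c₂ : S.Const} :
    S.Proves Γ (S.eqSent c₁ c₂) → S.Proves Γ (F.inst c₁) → S.Proves Γ (F.inst c₂)
  | ⟨_, h₁, d₁⟩, ⟨_, h₂, d₂⟩ => ⟨_, Set.union_subset h₁ h₂, .eqE F d₁ d₂⟩

theorem av (h : PreForm.AlphaEq A.1 B.1) : S.Proves Γ A → S.Proves Γ B
  | ⟨_, h₀, d⟩ => ⟨_, h₀, .av d h⟩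

end Quantifiers

end Proves

/-- The signature with the same predicate letters as `S` in which the individual constants are the
elements of `C`. -/
abbrev withConst (S : Signature.{u}) (C : Type u) [hC : Infinite C] : Signature.{u} where
  Const := C
  Pred := S.Pred
  eqSym := S.eqSym
  infinite_const := hC

theorem exists_const_notMem (S : Signature.{u}) {Γ : Set S.Sent} (hΓ : Γ.Finite) :
    ∃ c : S.Const, ∀ H ∈ Γ, c ∉ H.1.consts := by
  have := S.infinite_const
  obtain ⟨c, hc⟩ := (hΓ.biUnion fun H _ => H.1.finite_consts).exists_notMem
  exact ⟨c, fun H hH hcH => hc (Set.mem_biUnion hH hcH)⟩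

/-! ### Conservativity of new constants -/

section Renaming

variable {C : Type u} [Infinite C] {x : ℕ}

theorem map_update_eq [DecidableEq C] {f : C → S.Const} {c : C} {d : S.Const} {A : (S.withConst C).Sent}
    (h : c ∉ A.1.consts) : A.map (Function.update f c d) = A.map f :=
  Sentence.map_congr fun _ he => Function.update_of_ne (ne_of_mem_of_not_mem he h) _ _

theorem map_update_inst [DecidableEq C] {f : C → S.Const} {c : C} {d : S.Const} {A : (S.withConst C).FormIn x}
    (h : c ∉ A.1.consts) :
    (A.inst c).map (Function.update f c d) = (A.map f).inst d := by
  rw [FormIn.map_inst, Function.update_self]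
  congr 1
  exact FormIn.map_congr fun _ he => Function.update_of_ne (ne_of_mem_of_not_mem he h) _ _

theorem image_map_update_eq [DecidableEq C] {f : C → S.Const} {c : C} {d : S.Const}
    {Γ : Set (S.withConst C).Sent} (h : ∀ H ∈ Γ, c ∉ H.1.consts) :
    Sentence.map (Function.update f c d) '' Γ = Sentence.map f '' Γ :=
  Set.image_congr fun H hH => map_update_eq (h H hH)

theorem exists_fresh (f : C → S.Const) {Γ : Set (S.withConst C).Sent} (hΓ : Γ.Finite)
    (B : (S.withConst C).Sent) (A : (S.withConst C).FormIn x) (hx : x ∈ A.1.freeVars) :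
    ∃ d : S.Const, d ∉ (A.map f).1.consts ∧ d ∉ (B.map f).1.consts ∧
      ∀ H ∈ Sentence.map f '' Γ, d ∉ H.1.consts := by
  -- `A` need not be a sentence; `∀xA` is one with the same constants.
  obtain ⟨d, hd⟩ := S.exists_const_notMem
    (((hΓ.image (Sentence.map f)).insert (B.map f)).insert (Sentence.all (A.map f)
      (FormIn.mem_freeVars_map f hx)))
  exact ⟨d, hd _ (Set.mem_insert _ _), hd _ (by simp), fun H hH => hd H (by simp [hH])⟩

/-- In `∃E` and `¬∀E` the eigenconstant `c` may occur in the discharged hypothesis `E` but in no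
other, so redirecting `c` to `d` affects `E` alone. -/
theorem image_map_update_subset [DecidableEq C] {f : C → S.Const} {c : C} {d : S.Const}
    {Δ : Set (S.withConst C).Sent} {E : (S.withConst C).Sent}
    (h : ∀ H ∈ Δ, H ≠ E → c ∉ H.1.consts) (Γ : Set (S.withConst C).Sent) :
    Sentence.map (Function.update f c d) '' Δ ⊆
      insert (E.map (Function.update f c d)) (Sentence.map f '' (Γ ∪ Δ \ {E})) := by
  rintro _ ⟨H, hH, rfl⟩
  by_cases hE : H = E
  · exact Or.inl (hE ▸ rfl)
  · exact Or.inr ⟨H, Or.inr ⟨hH, hE⟩, (map_update_eq (h H hH hE)).symm⟩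

theorem image_map_subset_insert (f : C → S.Const) (Γ Δ Θ : Set (S.withConst C).Sent)
    (E : (S.withConst C).Sent) :
    Sentence.map f '' Δ ⊆ insert (E.map f) (Sentence.map f '' (Γ ∪ Δ \ {E} ∪ Θ)) := by
  rintro _ ⟨H, hH, rfl⟩
  by_cases hE : H = E
  · exact Or.inl (hE ▸ rfl)
  · exact Or.inr ⟨H, Or.inl (Or.inr ⟨hH, hE⟩), rfl⟩

theorem map_eqSent (f : C → S.Const) (c₁ c₂ : C) :
    ((S.withConst C).eqSent c₁ c₂).map f = S.eqSent (f c₁) (f c₂) :=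
  congrArg (Sentence.atom S.eqSym) (by ext i; fin_cases i <;> rfl)

/-- Derivations are preserved by arbitrary renamings of the individual constants. -/
theorem Proves.map_of_deriv {Γ : Set (S.withConst C).Sent} {A : (S.withConst C).Sent}
    (h : (S.withConst C).Deriv Γ A) (f : C → S.Const) :
    S.Proves (Sentence.map f '' Γ) (A.map f) := by
  classical
  -- A renaming that is not injective may identify a discharged hypothesis with an undischarged one,
  -- so only inclusion of the remaining hypotheses in the image can be expected. The induction is
  -- over all `f` because eigenconstants must be redirected.
  induction h generalizing f with
  | hyp A => exact .hyp (by simp)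
  | andI _ _ ih₁ ih₂ =>
    exact andI ((ih₁ f).mono (Set.image_mono Set.subset_union_left))
      ((ih₂ f).mono (Set.image_mono Set.subset_union_right))
  | @andE₁ _ A B _ ih => exact andE₁ (B := B.map f) (ih f)
  | @andE₂ _ A B _ ih => exact andE₂ (A := A.map f) (ih f)
  | orI₁ B _ ih => exact orI₁ (B.map f) (ih f)
  | orI₂ A _ ih => exact orI₂ (A.map f) (ih f)
  | @orE Γ Δ Θ A B D _ _ _ ih ih₁ ih₂ =>
    refine orE (A := A.map f) (B := B.map f) ((ih f).mono (Set.image_mono ?_))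
      ((ih₁ f).mono (image_map_subset_insert f _ _ _ A)) ((ih₂ f).mono ?_)
    · exact Set.subset_union_left.trans Set.subset_union_left
    · rw [Set.union_right_comm]
      exact image_map_subset_insert f _ _ _ B
  | @negAndI₁ _ A B _ ih => exact negAndI₁ (A := A.map f) (B.map f) (ih f)
  | @negAndI₂ _ A B _ ih => exact negAndI₂ (B := B.map f) (A.map f) (ih f)
  | @negAndE Γ Δ Θ A B D _ _ _ ih ih₁ ih₂ =>
    refine negAndE (A := A.map f) (B := B.map f) ((ih f).mono (Set.image_mono ?_))
      ((ih₁ f).mono (image_map_subset_insert f _ _ _ A.neg)) ((ih₂ f).mono ?_)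
    · exact Set.subset_union_left.trans Set.subset_union_left
    · rw [Set.union_right_comm]
      exact image_map_subset_insert f _ _ _ B.neg
  | @negOrI _ _ A B _ _ ih₁ ih₂ =>
    exact negOrI (A := A.map f) (B := B.map f) ((ih₁ f).mono (Set.image_mono Set.subset_union_left))
      ((ih₂ f).mono (Set.image_mono Set.subset_union_right))
  | @negOrE₁ _ A B _ ih => exact negOrE₁ (A := A.map f) (B := B.map f) (ih f)
  | @negOrE₂ _ A B _ ih => exact negOrE₂ (A := A.map f) (B := B.map f) (ih f)
  | dnI _ ih => exact dnI (ih f)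
  | dnE _ ih => exact dnE (ih f)
  | expCirc B _ _ _ ih₁ ih₂ ih₃ =>
    exact expCirc _
      ((ih₁ f).mono (Set.image_mono (Set.subset_union_left.trans Set.subset_union_left)))
      ((ih₂ f).mono (Set.image_mono (Set.subset_union_right.trans Set.subset_union_left)))
      ((ih₃ f).mono (Set.image_mono Set.subset_union_right))
  | @pemCirc _ A _ ih => exact pemCirc (A := A.map f) (ih f)
  | @cons _ _ A B _ _ ih₁ ih₂ =>
    exact cons (A := A.map f) _ ((ih₁ f).mono (Set.image_mono Set.subset_union_left))
      ((ih₂ f).mono (Set.image_mono Set.subset_union_right))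
  | comp A => exact comp (A.map f)
  | @allI Γ B x A hx c hd hA hB hΓ ih =>
    -- `f c` may well occur in the renamed hypotheses. The subderivation is therefore renamed by `f`
    -- changed at `c` to a fresh `d`, which agrees with `f` wherever `c` does not occur.
    obtain ⟨d, hdA, hdB, hdΓ⟩ := exists_fresh f hd.finite B A hx
    have := ih (Function.update f c d)
    rw [image_map_update_eq hΓ] at this
    change S.Proves _ ((B.map _).or ((A.inst c).map _)) at this
    rw [map_update_eq hB, map_update_inst hA] at this
    exact allI (FormIn.mem_freeVars_map f hx) this hdA hdB hdΓ
  | @allE Γ x A hx c _ ih =>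
    rw [FormIn.map_inst]
    exact allE (hx := FormIn.mem_freeVars_map f hx) _ (ih f)
  | @exI Γ x A hx c _ ih =>
    have := ih f
    rw [FormIn.map_inst] at this
    exact exI (FormIn.mem_freeVars_map f hx) this
  | @exE Γ Δ x A hx D c h₁ h₂ hA hD hΔ ih₁ ih₂ =>
    obtain ⟨d, hdA, hdD, hdΓ⟩ :=
      exists_fresh f (h₁.finite.union (h₂.finite.sdiff (t := {A.inst c}))) D A hx
    have := (ih₂ (Function.update f c d)).mono (image_map_update_subset hΔ Γ)
    rw [map_update_eq hD, map_update_inst hA] at this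
    exact exE (hx := FormIn.mem_freeVars_map f hx)
      ((ih₁ f).mono (Set.image_mono Set.subset_union_left)) this hdA hdD hdΓ
  | @negAllI Γ x A hx c _ ih =>
    have := ih f
    change S.Proves _ ((A.inst c).map f).neg at this
    rw [FormIn.map_inst] at this
    exact negAllI (FormIn.mem_freeVars_map f hx) this
  | @negAllE Γ Δ x A hx D c h₁ h₂ hA hD hΔ ih₁ ih₂ =>
    obtain ⟨d, hdA, hdD, hdΓ⟩ :=
      exists_fresh f (h₁.finite.union (h₂.finite.sdiff (t := {(A.inst c).neg}))) D A hx
    have := (ih₂ (Function.update f c d)).mono (image_map_update_subset hΔ Γ)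
    change S.Proves (insert ((A.inst c).map _).neg _) _ at this
    rw [map_update_eq hD, map_update_inst hA] at this
    exact negAllE (hx := FormIn.mem_freeVars_map f hx)
      ((ih₁ f).mono (Set.image_mono Set.subset_union_left)) this hdA hdD hdΓ
  | @negExI Γ x A hx c hd hA hΓ ih =>
    -- This rule has no side formula; `A.inst c` only fills the argument.
    obtain ⟨d, hdA, -, hdΓ⟩ := exists_fresh f hd.finite (A.inst c) A hx
    have := ih (Function.update f c d)
    rw [image_map_update_eq hΓ] at this
    change S.Proves _ ((A.inst c).map _).neg at this
    rw [map_update_inst hA] at this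
    exact negExI (FormIn.mem_freeVars_map f hx) this hdA hdΓ
  | @negExE Γ x A hx c _ ih =>
    change S.Proves _ ((A.inst c).map f).neg
    rw [FormIn.map_inst]
    exact negExE (hx := FormIn.mem_freeVars_map f hx) _ (ih f)
  | eqI c =>
    rw [map_eqSent]
    exact eqI _
  | @eqE Γ Δ c₁ c₂ x A _ _ ih₁ ih₂ =>
    have h₁ := (ih₁ f).mono (Set.image_mono (Set.subset_union_left (t := Δ)))
    have h₂ := (ih₂ f).mono (Set.image_mono (Set.subset_union_right (s := Γ)))
    rw [map_eqSent] at h₁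
    rw [FormIn.map_inst] at h₂ ⊢
    exact eqE _ h₁ h₂
  | av _ h ih => exact av (h.map f) (ih f)

/-- Adding individual constants to the signature is conservative. -/
theorem Proves.of_map (ι : S.Const → C) (hι : ι.Injective) {Γ : Set S.Sent} {A : S.Sent}
    (h : (S.withConst C).Proves (Sentence.map ι '' Γ) (A.map ι)) : S.Proves Γ A := by
  have := S.infinite_const
  -- The left inverse sends the additional constants to arbitrary old ones, so it is in general not
  -- injective.
  obtain ⟨f, hf⟩ := hι.hasLeftInverse
  have hmap : ∀ B : S.Sent, (B.map ι).map f = B := fun B => Subtype.ext <| by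
    change (B.1.map ι).map f = B.1
    rw [PreForm.map_map, hf.comp_eq_id, PreForm.map_id]
  obtain ⟨Γ₀, h₀, hd⟩ := h
  have := map_of_deriv hd f
  rw [hmap] at this
  refine this.mono ?_
  rintro _ ⟨H, hH, rfl⟩
  obtain ⟨B, hB, rfl⟩ := h₀ hH
  rwa [hmap]

end Renaming

end Signature

/-! ### Prime theories and Henkin theories -/

namespace Signature

/-- A theory is closed under provability and prime. -/
structure IsPrime (S : Signature.{u}) (Δ : Set S.Sent) : Prop where
  closed {A : S.Sent} : S.Proves Δ A → A ∈ Δ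
  prime {A B : S.Sent} : A.or B ∈ Δ → A ∈ Δ ∨ B ∈ Δ

/-- A maximal theory that does not prove `D` works. If it contained `A ∨ B` but neither disjunct,
both one-sentence extensions would prove `D`, and `∨E` would yield `D`. -/
theorem exists_isPrime {S : Signature.{u}} {T : Set S.Sent} {D : S.Sent} (h : ¬ S.Proves T D) :
    ∃ Δ, T ⊆ Δ ∧ S.IsPrime Δ ∧ D ∉ Δ := by
  obtain ⟨Δ, hT, hΔ⟩ := zorn_subset_nonempty {T | ¬ S.Proves T D} (by
    rintro c hc hchain ⟨t, ht⟩
    refine ⟨⋃₀ c, ?_, fun s hs => Set.subset_sUnion_of_mem hs⟩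
    rintro ⟨Γ₀, h₀, hd⟩
    obtain ⟨s, hs, hs'⟩ := hchain.directedOn.exists_mem_subset_of_finite_of_subset_sUnion
      ⟨t, ht⟩ hd.finite h₀
    exact hc hs ⟨Γ₀, hs', hd⟩) T h
  have hmem : ∀ {A : S.Sent}, ¬ S.Proves (insert A Δ) D → A ∈ Δ := fun hA =>
    hΔ.le_of_ge hA (Set.subset_insert _ _) (Set.mem_insert _ _)
  refine ⟨Δ, hT, ⟨fun hA => hmem fun h' => hΔ.prop (hA.cut h'), fun hAB => ?_⟩,
    fun hD => hΔ.prop (.hyp hD)⟩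
  by_contra! hn
  exact hΔ.prop (.orE (.hyp hAB) (not_imp_comm.1 hmem hn.1) (not_imp_comm.1 hmem hn.2))

variable (S : Signature.{u})

instance : Infinite (HenkinConst S.Const S.Pred) :=
  have := S.infinite_const
  .of_injective HenkinConst.base fun _ _ => HenkinConst.base.inj

/-- The signature in which every formula has its own witness. -/
abbrev henkin : Signature.{u} := S.withConst (HenkinConst S.Const S.Pred)

/-- The quantified sentences of the signature `S.henkin`. -/
inductive Quantified : Type u
  | all {x : ℕ} (A : S.henkin.FormIn x) (hx : x ∈ A.1.freeVars)
  | ex {x : ℕ} (A : S.henkin.FormIn x) (hx : x ∈ A.1.freeVars)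

namespace Quantified

variable {S}

/-- The quantified sentence itself. -/
def sent : S.Quantified → S.henkin.Sent
  | all A hx => Sentence.all A hx
  | ex A hx => Sentence.ex A hx

/-- The witness for a quantified sentence. -/
def wit (Q : S.Quantified) : HenkinConst S.Const S.Pred := .wit Q.sent.1

/-- The left-hand side of the Henkin sequent: `A(c/x)` for `∀x A`, and `∃x A` for `∃x A`. -/
def lhs : S.Quantified → S.henkin.Sent
  | all A hx => A.inst (all A hx).wit
  | ex A hx => Sentence.ex A hx

/-- The right-hand side of the Henkin sequent: `∀x A` for `∀x A`, and `A(c/x)` for `∃x A`. -/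
def rhs : S.Quantified → S.henkin.Sent
  | all A hx => Sentence.all A hx
  | ex A hx => A.inst (ex A hx).wit

/-- The witness carries the whole quantified sentence, including the quantifier. Hence a newly
treated sentence never shares its witness with an earlier one. -/
theorem wit_injective : (wit : S.Quantified → _).Injective := by
  intro Q R h
  have h : Q.sent.1 = R.sent.1 := HenkinConst.wit.inj h
  cases Q with
  | @all x A hx =>
    cases R with
    | @all y B hy =>
      obtain ⟨rfl, hAB⟩ := PreForm.all.inj h
      obtain rfl := Subtype.ext hAB
      rfl
    | @ex y B hy => cases h
  | @ex x A hx =>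
    cases R with
    | @all y B hy => cases h
    | @ex y B hy =>
      obtain ⟨rfl, hAB⟩ := PreForm.ex.inj h
      obtain rfl := Subtype.ext hAB
      rfl

theorem consts_lhs_subset (Q : S.Quantified) : Q.lhs.1.consts ⊆ insert Q.wit Q.sent.1.consts := by
  cases Q with
  | all A hx => exact PreForm.consts_subst_subset _ _ _
  | ex A hx => exact Set.subset_insert _ _

theorem consts_rhs_subset (Q : S.Quantified) : Q.rhs.1.consts ⊆ insert Q.wit Q.sent.1.consts := by
  cases Q with
  | all A hx => exact Set.subset_insert _ _
  | ex A hx => exact PreForm.consts_subst_subset _ _ _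

/-- Henkin sequents with fresh witnesses can be eliminated. -/
theorem proves_of_fresh (Q : S.Quantified) {T : Set S.henkin.Sent} {D : S.henkin.Sent}
    (hT : ∀ H ∈ T, Q.wit ∉ H.1.consts) (hD : Q.wit ∉ D.1.consts)
    (h₁ : S.henkin.Proves T (D.or Q.lhs)) (h₂ : S.henkin.Proves (insert Q.rhs T) D) :
    S.henkin.Proves T D := by
  have hQ : Q.wit ∉ Q.sent.1.consts := HenkinConst.wit_notMem _
  cases Q with
  -- The side disjunct `D` in `∀I` is essential here: `D ∨ A(c/x)` becomes `D ∨ ∀xA`.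
  | all A hx => exact .orE (.allI hx h₁ hQ hD hT) (.hyp (Set.mem_insert _ _)) h₂
  | ex A hx =>
    refine .orE h₁ (.hyp (Set.mem_insert _ _))
      (.exE (hx := hx) (.hyp (Set.mem_insert _ _)) (h₂.mono (Set.insert_subset_insert (Set.subset_insert _ _)))
        hQ hD ?_)
    rintro H (rfl | hH)
    exacts [hQ, hT H hH]

end Quantified

variable {S}

/-- Finitely many Henkin sequents can be decided consistently. -/
theorem exists_decided {T : Set S.henkin.Sent} {D : S.henkin.Sent}
    (hT : ∀ H ∈ T, ∀ A, HenkinConst.wit A ∉ H.1.consts) (hD : ∀ A, HenkinConst.wit A ∉ D.1.consts)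
    (hTD : ¬ S.henkin.Proves T D) (X : Finset S.Quantified) :
    ∃ T' D', T ⊆ T' ∧ S.henkin.Proves {D} D' ∧ ¬ S.henkin.Proves T' D' ∧
      (∀ Q ∈ X, Q.rhs ∈ T' ∨ S.henkin.Proves {Q.lhs} D') ∧
      ∀ R : S.Quantified, (∀ Q ∈ X, R.wit ≠ Q.wit ∧ R.wit ∉ Q.sent.1.consts) →
        (∀ H ∈ T', R.wit ∉ H.1.consts) ∧ R.wit ∉ D'.1.consts := by
  classical
  -- The sentences are treated by increasing rank of their witnesses. If the witness of `Q` occurred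
  -- in an earlier `R`, its rank would be less than that of the witness of `R`, contrary to
  -- maximality; so it is still fresh.
  induction X using Finset.induction_on_max_value (fun Q : S.Quantified => Q.wit.rank) with
  | empty =>
    exact ⟨T, D, subset_rfl, .hyp rfl, hTD, by simp, fun R _ => ⟨fun H hH => hT H hH _, hD _⟩⟩
  | insert Q X hQ hmax ih =>
    obtain ⟨T', D', hTT', hDD', hT'D', hdec, hfresh⟩ := ih
    obtain ⟨hQT', hQD'⟩ := hfresh Q fun R hR =>
      ⟨fun h => hQ (Quantified.wit_injective h ▸ hR),
        fun h => (HenkinConst.rank_lt h).not_ge (hmax R hR)⟩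
    -- If `D' ∨ lhs` is provable, the right side joins the theory, and freshness keeps `D'`
    -- unprovable. Otherwise the left side becomes a disjunct of the sentence to be avoided.
    by_cases h : S.henkin.Proves T' (D'.or Q.lhs)
    · refine ⟨insert Q.rhs T', D', hTT'.trans (Set.subset_insert _ _), hDD',
        fun h' => hT'D' (Q.proves_of_fresh hQT' hQD' h h'), ?_, fun R hR => ⟨?_, ?_⟩⟩
      · intro R hR
        obtain rfl | hR := Finset.mem_insert.1 hR
        · exact .inl (Set.mem_insert _ _)
        · exact (hdec R hR).imp_left (Set.mem_insert_of_mem _)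
      · have hR' := hR Q (Finset.mem_insert_self _ _)
        rintro H (rfl | hH)
        · exact fun h => (Q.consts_rhs_subset h).elim hR'.1 hR'.2
        · exact (hfresh R fun P hP => hR P (Finset.mem_insert_of_mem hP)).1 H hH
      · exact (hfresh R fun P hP => hR P (Finset.mem_insert_of_mem hP)).2
    · refine ⟨T', D'.or Q.lhs, hTT', hDD'.orI₁ _, h, ?_, fun R hR => ⟨?_, ?_⟩⟩
      · intro R hR
        obtain rfl | hR := Finset.mem_insert.1 hR
        · exact .inr (.orI₂ _ (.hyp rfl))
        · exact (hdec R hR).imp_right (.orI₁ _)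
      · exact (hfresh R fun P hP => hR P (Finset.mem_insert_of_mem hP)).1
      · have hR' := hR Q (Finset.mem_insert_self _ _)
        rintro (h | h)
        · exact (hfresh R fun P hP => hR P (Finset.mem_insert_of_mem hP)).2 h
        · exact (Q.consts_lhs_subset h).elim hR'.1 hR'.2

/-- A Henkin theory: a prime theory in which all quantified sentences have witnesses. -/
structure IsHenkin (Δ : Set S.henkin.Sent) : Prop extends S.henkin.IsPrime Δ where
  henkin (Q : S.Quantified) : Q.lhs ∈ Δ → Q.rhs ∈ Δ

/-- The theories for different finite sets `X` need not be comparable, so a limit replaces their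
union: a sentence is kept if it belongs to the theory of `X` for almost all `X`. Closure survives
because derivations are finite, and primeness because an ultrafilter decides disjunctions. -/
theorem exists_isHenkin {T : Set S.henkin.Sent} {D : S.henkin.Sent}
    (hT : ∀ H ∈ T, ∀ A, HenkinConst.wit A ∉ H.1.consts) (hD : ∀ A, HenkinConst.wit A ∉ D.1.consts)
    (hTD : ¬ S.henkin.Proves T D) : ∃ Δ, T ⊆ Δ ∧ IsHenkin Δ ∧ D ∉ Δ := by
  classical
  have key : ∀ X : Finset S.Quantified, ∃ Δ, T ⊆ Δ ∧ S.henkin.IsPrime Δ ∧ D ∉ Δ ∧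
      ∀ Q ∈ X, Q.lhs ∈ Δ → Q.rhs ∈ Δ := by
    intro X
    obtain ⟨T', D', hTT', hDD', hT'D', hdec, -⟩ := exists_decided hT hD hTD X
    obtain ⟨Δ, hΔ, hprime, hD'⟩ := exists_isPrime hT'D'
    have aux : ∀ {A}, S.henkin.Proves {A} D' → A ∉ Δ := fun h hA =>
      hD' (hprime.closed (h.mono (Set.singleton_subset_iff.2 hA)))
    refine ⟨Δ, hTT'.trans hΔ, hprime, aux hDD', fun Q hQ hlhs => ?_⟩
    exact (hdec Q hQ).elim (fun h => hΔ h) fun h => absurd hlhs (aux h)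
  choose Δ hTΔ hprime hDΔ hhenkin using key
  -- Being finer than `atTop`, it contains for each `Q` the family of all `X` with `Q ∈ X`, so each
  -- witness condition holds almost everywhere.
  let U : Ultrafilter (Finset S.Quantified) := .of .atTop
  refine ⟨{A | ∀ᶠ X in U, A ∈ Δ X}, fun A hA => .of_forall fun X => hTΔ X hA,
    ⟨⟨?_, ?_⟩, ?_⟩, fun h => ?_⟩
  · rintro A ⟨Γ₀, h₀, hd⟩
    have : ∀ᶠ X in U, ∀ B ∈ Γ₀, B ∈ Δ X := (Filter.eventually_all_finite hd.finite).2 h₀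
    exact this.mono fun X hX => (hprime X).closed ⟨Γ₀, hX, hd⟩
  · intro A B h
    exact Ultrafilter.eventually_or.1 (h.mono fun X hX => (hprime X).prime hX)
  · intro Q h
    have : ∀ᶠ X : Finset S.Quantified in U, Q ∈ X := Ultrafilter.of_le _
      ((Filter.eventually_ge_atTop {Q}).mono fun X hX => Finset.singleton_subset_iff.1 hX)
    exact (this.and h).mono fun X hX => hhenkin X Q hX.1 hX.2
  · obtain ⟨X, hX⟩ := h.exists
    exact hDΔ X hX

end Signature

/-! ### Canonical structure and canonical valuation -/

namespace Signature

variable {S : Signature.{u}} {Δ : Set S.henkin.Sent}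

namespace IsPrime

theorem proves_iff (h : S.henkin.IsPrime Δ) {A : S.henkin.Sent} : S.henkin.Proves Δ A ↔ A ∈ Δ :=
  ⟨h.closed, .hyp⟩

theorem eq_refl (h : S.henkin.IsPrime Δ) (c : S.henkin.Const) : S.henkin.eqSent c c ∈ Δ :=
  h.closed (.eqI c)

theorem inst_mem (h : S.henkin.IsPrime Δ) {x : ℕ} (A : S.henkin.FormIn x) {c d : S.henkin.Const}
    (hcd : S.henkin.eqSent c d ∈ Δ) (hc : A.inst c ∈ Δ) : A.inst d ∈ Δ :=
  h.closed (.eqE A (.hyp hcd) (.hyp hc))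

theorem eq_symm (h : S.henkin.IsPrime Δ) {c d : S.henkin.Const} (hcd : S.henkin.eqSent c d ∈ Δ) :
    S.henkin.eqSent d c ∈ Δ := by
  -- Replacement is applied to `v₀ ≈ c`, starting from `c ≈ c`; the entry of `![c, c]` at the hole
  -- is overwritten.
  have key : ∀ e, (FormIn.atomHole S.henkin.eqSym ![c, c] 0).inst e = S.henkin.eqSent e c := by
    intro e
    rw [FormIn.inst_atomHole]
    exact congrArg (Sentence.atom S.eqSym) (by ext i; fin_cases i <;> rfl)
  rw [← key]
  exact h.inst_mem _ hcd (by rw [key]; exact h.eq_refl c)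

theorem eq_trans (h : S.henkin.IsPrime Δ) {c d e : S.henkin.Const}
    (hcd : S.henkin.eqSent c d ∈ Δ) (hde : S.henkin.eqSent d e ∈ Δ) :
    S.henkin.eqSent c e ∈ Δ := by
  have key : ∀ e, (FormIn.atomHole S.henkin.eqSym ![c, c] 1).inst e = S.henkin.eqSent c e := by
    intro e
    rw [FormIn.inst_atomHole]
    exact congrArg (Sentence.atom S.eqSym) (by ext i; fin_cases i <;> rfl)
  rw [← key]
  exact h.inst_mem _ hde (by rwa [key])

/-- Replacing the arguments of an atomic sentence by equal ones, under a context `F` that preserves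
replacement in one place. -/
theorem atom_congr_aux {n : ℕ} (p : S.Pred n) (F : S.henkin.Sent → S.henkin.Sent)
    (hF : ∀ (c : Fin n → S.henkin.Const) (i : Fin n) (d : S.henkin.Const),
      S.henkin.eqSent (c i) d ∈ Δ → F (Sentence.atom p c) ∈ Δ →
        F (Sentence.atom p (Function.update c i d)) ∈ Δ)
    {c d : Fin n → S.henkin.Const} (hcd : ∀ i, S.henkin.eqSent (c i) (d i) ∈ Δ)
    (hc : F (Sentence.atom p c) ∈ Δ) : F (Sentence.atom p d) ∈ Δ := by
  classical
  -- `≈E` is applied at one place at a time; `s` is the set of places already changed from `c` to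
  -- `d`.
  suffices ∀ s : Finset (Fin n), F (Sentence.atom p (s.piecewise d c)) ∈ Δ by
    simpa using this Finset.univ
  intro s
  induction s using Finset.induction_on with
  | empty => simpa using hc
  | insert i s hi ih =>
    rw [Finset.piecewise_insert]
    exact hF _ i _ (by simpa [hi] using hcd i) ih

theorem atom_congr (h : S.henkin.IsPrime Δ) {n : ℕ} (p : S.Pred n)
    {c d : Fin n → S.henkin.Const} (hcd : ∀ i, S.henkin.eqSent (c i) (d i) ∈ Δ) :
    (Sentence.atom p c ∈ Δ ↔ Sentence.atom p d ∈ Δ) ∧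
      ((Sentence.atom p c).neg ∈ Δ ↔ (Sentence.atom p d).neg ∈ Δ) := by
  have pos : ∀ (c : Fin n → S.henkin.Const) (i : Fin n) (d : S.henkin.Const),
      S.henkin.eqSent (c i) d ∈ Δ → Sentence.atom p c ∈ Δ →
        Sentence.atom p (Function.update c i d) ∈ Δ := by
    intro c i d hd hc
    rw [← FormIn.inst_atomHole]
    exact h.inst_mem _ hd (by rwa [FormIn.inst_atomHole, Function.update_eq_self])
  have neg : ∀ (c : Fin n → S.henkin.Const) (i : Fin n) (d : S.henkin.Const),
      S.henkin.eqSent (c i) d ∈ Δ → (Sentence.atom p c).neg ∈ Δ →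
        (Sentence.atom p (Function.update c i d)).neg ∈ Δ := by
    intro c i d hd hc
    rw [← FormIn.inst_atomHole]
    refine h.inst_mem (FormIn.atomHole p c i).neg hd ?_
    change ((FormIn.atomHole p c i).inst (c i)).neg ∈ Δ
    rwa [FormIn.inst_atomHole, Function.update_eq_self]
  have hdc := fun i => h.eq_symm (hcd i)
  exact ⟨⟨atom_congr_aux p id pos hcd, atom_congr_aux p id pos hdc⟩,
    ⟨atom_congr_aux p Sentence.neg neg hcd, atom_congr_aux p Sentence.neg neg hdc⟩⟩

/-- Identity of constants according to a prime theory. -/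
def setoid (h : S.henkin.IsPrime Δ) : Setoid S.henkin.Const where
  r c d := S.henkin.eqSent c d ∈ Δ
  iseqv := ⟨h.eq_refl, h.eq_symm, h.eq_trans⟩

/-- The canonical structure of a prime theory. -/
def struc (h : S.henkin.IsPrime Δ) : S.Struc where
  Dom := Quotient h.setoid
  nonempty_dom := ⟨⟦(Classical.choice S.henkin.infinite_const.nonempty)⟧⟩
  con c := ⟦HenkinConst.base c⟧
  ext p := {d | (Sentence.atom p fun i => (d i).out : S.henkin.Sent) ∈ Δ}
  antiExt p := {d | (Sentence.atom p fun i => (d i).out : S.henkin.Sent).neg ∈ Δ}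
  ext_eqSym := by
    have key : ∀ d : Fin 2 → Quotient h.setoid,
        (Sentence.atom S.eqSym fun i => (d i).out : S.henkin.Sent) ∈ Δ ↔ d 0 = d 1 := by
      intro d
      rw [← Quotient.out_equiv_out]
      refine iff_of_eq (congrArg (· ∈ Δ) (congrArg (Sentence.atom S.eqSym) ?_))
      ext i
      fin_cases i <;> rfl
    ext d
    rw [Set.mem_ofPred_eq, key]
    constructor
    · intro hd
      exact ⟨d 0, by ext i; fin_cases i <;> simp [hd]⟩
    · rintro ⟨a, rfl⟩
      rfl

/-- The constant that represents a constant of the diagram signature of the canonical structure. -/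
noncomputable def repr (h : S.henkin.IsPrime Δ) : h.struc.diagram.Const → S.henkin.Const :=
  Sum.elim HenkinConst.base Quotient.out

theorem mk_repr (h : S.henkin.IsPrime Δ) (c : h.struc.diagram.Const) :
    (⟦h.repr c⟧ : Quotient h.setoid) = h.struc.hat.con c := by
  cases c with
  | inl c => rfl
  | inr a => exact Quotient.out_eq a

theorem eqSent_out_repr (h : S.henkin.IsPrime Δ) (c : h.struc.diagram.Const) :
    S.henkin.eqSent (h.repr c) (Quotient.out (s := h.setoid) (h.struc.hat.con c)) ∈ Δ :=
  h.eq_symm (Quotient.exact (s := h.setoid) ((Quotient.out_eq _).trans (h.mk_repr c).symm))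

theorem eqSent_repr (h : S.henkin.IsPrime Δ) {c d : h.struc.diagram.Const}
    (hcd : h.struc.hat.con c = h.struc.hat.con d) :
    S.henkin.eqSent (h.repr c) (h.repr d) ∈ Δ :=
  Quotient.exact (s := h.setoid) (by rw [mk_repr, mk_repr, hcd])

end IsPrime

namespace IsHenkin

/-- Elements of the domain are classes of constants, and the witness of `∀xA` represents one of
them. Its instance is thus among those assumed, up to provable identity, and the witness condition
gives `∀xA`. -/
theorem all_mem_iff (h : IsHenkin Δ) {x : ℕ} (A : S.henkin.FormIn x) (hx : x ∈ A.1.freeVars) :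
    Sentence.all A hx ∈ Δ ↔ ∀ a : h.struc.Dom, A.inst (h.repr (.inr a)) ∈ Δ := by
  refine ⟨fun hA a => h.closed (.allE (hx := hx) _ (.hyp hA)), fun hA => ?_⟩
  refine h.henkin (.all A hx) (h.inst_mem A ?_ (hA ⟦(Quantified.all A hx).wit⟧))
  exact Quotient.exact (s := h.setoid) (Quotient.out_eq _)

theorem ex_mem_iff (h : IsHenkin Δ) {x : ℕ} (A : S.henkin.FormIn x) (hx : x ∈ A.1.freeVars) :
    Sentence.ex A hx ∈ Δ ↔ ∃ a : h.struc.Dom, A.inst (h.repr (.inr a)) ∈ Δ := by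
  refine ⟨fun hA => ⟨⟦(Quantified.ex A hx).wit⟧, ?_⟩,
    fun ⟨a, hA⟩ => h.closed (.exI hx (.hyp hA))⟩
  refine h.inst_mem A ?_ (h.henkin (.ex A hx) hA)
  exact h.eq_symm (Quotient.exact (s := h.setoid) (Quotient.out_eq _))

end IsHenkin

/-- Witness conditions exist only for unnegated quantifiers; this equivalence and its dual transfer
them to `¬∀` and `¬∃`. -/
theorem Proves.neg_all_iff {Γ : Set S.Sent} {x : ℕ} {A : S.FormIn x} (hx : x ∈ A.1.freeVars) :
    S.Proves Γ (Sentence.all A hx).neg ↔ S.Proves Γ (Sentence.ex A.neg hx) := by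
  obtain ⟨c, hc⟩ := S.exists_const_notMem (Set.finite_singleton (Sentence.all A hx))
  replace hc : c ∉ A.1.consts := hc _ rfl
  constructor <;> intro h
  -- All constants may occur in `Γ`, so the context is first cut down to a single sentence, for
  -- which `c` is fresh.
  · refine h.cut (.mono (Γ := {(Sentence.all A hx).neg}) ?_ (by simp))
    exact .negAllE (hx := hx) (.hyp rfl) (.exI (F := A.neg) hx (.hyp (Set.mem_insert _ _))) hc hc
      (by rintro H rfl; exact hc)
  · refine h.cut (.mono (Γ := {Sentence.ex A.neg hx}) ?_ (by simp))
    exact .exE (F := A.neg) (hx := hx) (.hyp rfl) (.negAllI hx (.hyp (Set.mem_insert _ _))) hc hc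
      (by rintro H rfl; exact hc)

theorem Proves.neg_ex_iff {Γ : Set S.Sent} {x : ℕ} {A : S.FormIn x} (hx : x ∈ A.1.freeVars) :
    S.Proves Γ (Sentence.ex A hx).neg ↔ S.Proves Γ (Sentence.all A.neg hx) := by
  obtain ⟨c, hc⟩ := S.exists_const_notMem (Set.finite_singleton (Sentence.all A hx))
  replace hc : c ∉ A.1.consts := hc _ rfl
  constructor <;> intro h
  · refine h.cut (.mono (Γ := {(Sentence.ex A hx).neg}) ?_ (by simp))
    -- `∀I` needs a disjunction as its premise. The desired conclusion itself serves as the side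
    -- disjunct, and `∨E` then merges the two copies.
    exact .orE (.allI (B := Sentence.all A.neg hx) (F := A.neg) hx
      (.orI₂ _ (.negExE (F := A) (hx := hx) c (.hyp rfl))) hc hc (by rintro H rfl; exact hc)) (.hyp (Set.mem_insert _ _)) (.hyp (Set.mem_insert _ _))
  · refine h.cut (.mono (Γ := {Sentence.all A.neg hx}) ?_ (by simp))
    exact .negExI hx (.allE (F := A.neg) (hx := hx) c (.hyp rfl)) hc
      (by rintro H rfl; exact hc)

namespace IsHenkin

theorem neg_all_mem_iff (h : IsHenkin Δ) {x : ℕ} (A : S.henkin.FormIn x)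
    (hx : x ∈ A.1.freeVars) :
    (Sentence.all A hx).neg ∈ Δ ↔ ∃ a : h.struc.Dom, (A.inst (h.repr (.inr a))).neg ∈ Δ := by
  rw [← h.proves_iff, Proves.neg_all_iff, h.proves_iff]
  exact h.ex_mem_iff A.neg hx

theorem neg_ex_mem_iff (h : IsHenkin Δ) {x : ℕ} (A : S.henkin.FormIn x)
    (hx : x ∈ A.1.freeVars) :
    (Sentence.ex A hx).neg ∈ Δ ↔ ∀ a : h.struc.Dom, (A.inst (h.repr (.inr a))).neg ∈ Δ := by
  rw [← h.proves_iff, Proves.neg_ex_iff, h.proves_iff]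
  exact h.all_mem_iff A.neg hx

/-- The canonical valuation of a Henkin theory. -/
noncomputable def val (h : IsHenkin Δ) (A : h.struc.diagram.Sent) : Bool :=
  open scoped Classical in decide ((A.map h.repr : S.henkin.Sent) ∈ Δ)

theorem val_eq_true (h : IsHenkin Δ) (A : h.struc.diagram.Sent) :
    h.val A = true ↔ (A.map h.repr : S.henkin.Sent) ∈ Δ := by
  simp [val]

theorem val_inst (h : IsHenkin Δ) {x : ℕ} (A : h.struc.diagram.FormIn x)
    (c : h.struc.diagram.Const) :
    h.val (A.inst c) = true ↔ FormIn.inst (A.map h.repr : S.henkin.FormIn x) (h.repr c) ∈ Δ :=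
  (h.val_eq_true _).trans (iff_of_eq (congrArg (· ∈ Δ) (FormIn.map_inst h.repr A c)))

theorem inst_mem_iff (h : IsHenkin Δ) {x : ℕ} (A : S.henkin.FormIn x) {c d : S.henkin.Const}
    (hcd : S.henkin.eqSent c d ∈ Δ) : A.inst c ∈ Δ ↔ A.inst d ∈ Δ :=
  ⟨h.inst_mem A hcd, h.inst_mem A (h.eq_symm hcd)⟩

/-- An omitted sentence `D` makes the theory nontrivial. This is what the clauses for `∘` and `•`
need: a violation would prove everything, `D` included. -/
theorem isValuation (hΔ : IsHenkin Δ) {D : S.henkin.Sent} (hD : D ∉ Δ) :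
    hΔ.struc.IsValuation hΔ.val where
  atom p c := by
    rw [val_eq_true]
    exact (hΔ.atom_congr p fun i => hΔ.eqSent_out_repr (c i)).1
  negAtom p c := (hΔ.val_eq_true _).trans
    (hΔ.atom_congr p fun i => hΔ.eqSent_out_repr (c i)).2
  and A B := by
    simp only [val_eq_true]
    exact ⟨fun h => ⟨hΔ.closed (.andE₁ (B := B.map hΔ.repr) (.hyp h)),
      hΔ.closed (.andE₂ (A := A.map hΔ.repr) (.hyp h))⟩,
      fun h => hΔ.closed (.andI (.hyp h.1) (.hyp h.2))⟩
  or A B := by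
    simp only [val_eq_true]
    exact ⟨fun h => hΔ.prime h, fun h => h.elim (fun h => hΔ.closed (.orI₁ (B.map hΔ.repr) (.hyp h)))
      fun h => hΔ.closed (.orI₂ (A.map hΔ.repr) (.hyp h))⟩
  negAnd A B := by
    simp only [val_eq_true]
    refine ⟨fun h => hΔ.prime (hΔ.closed ?_), fun h => h.elim
      (fun h => hΔ.closed (.negAndI₁ (A := A.map hΔ.repr) (B.map hΔ.repr) (.hyp h)))
      fun h => hΔ.closed (.negAndI₂ (B := B.map hΔ.repr) (A.map hΔ.repr) (.hyp h))⟩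
    exact .negAndE (A := A.map hΔ.repr) (B := B.map hΔ.repr) (.hyp h)
      (.orI₁ _ (.hyp (Set.mem_insert _ _))) (.orI₂ _ (.hyp (Set.mem_insert _ _)))
  negOr A B := by
    simp only [val_eq_true]
    exact ⟨fun h =>
      ⟨hΔ.closed (.negOrE₁ (A := A.map hΔ.repr) (B := B.map hΔ.repr) (.hyp h)),
        hΔ.closed (.negOrE₂ (A := A.map hΔ.repr) (B := B.map hΔ.repr) (.hyp h))⟩,
      fun h => hΔ.closed (.negOrI (A := A.map hΔ.repr) (B := B.map hΔ.repr) (.hyp h.1) (.hyp h.2))⟩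
  negNeg A := by
    simp only [val_eq_true]
    exact ⟨fun h => hΔ.closed (.dnE (.hyp h)), fun h => hΔ.closed (.dnI (.hyp h))⟩
  circ A := by
    rw [← Bool.not_eq_true, val_eq_true, val_eq_true, val_eq_true]
    intro h
    refine ⟨fun hA hn => hD (hΔ.closed (.expCirc (A := A.map hΔ.repr) D (.hyp h) (.hyp hA)
      (.hyp hn))), fun hn => ?_⟩
    exact (hΔ.prime (hΔ.closed (.pemCirc (A := A.map hΔ.repr) (.hyp h)))).resolve_right hn
  circBull A := by
    rw [← Bool.not_eq_true, val_eq_true, val_eq_true]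
    refine ⟨fun h hb => hD (hΔ.closed (.cons (A := A.map hΔ.repr) D (.hyp h) (.hyp hb))),
      fun hb => ?_⟩
    exact (hΔ.prime (hΔ.closed (.comp (A.map hΔ.repr)))).resolve_right hb
  all A hx := (hΔ.val_eq_true _).trans <|
    (hΔ.all_mem_iff (A.map hΔ.repr) (FormIn.mem_freeVars_map _ hx)).trans
      (forall_congr' fun _ => (hΔ.val_inst A _).symm)
  ex A hx := (hΔ.val_eq_true _).trans <|
    (hΔ.ex_mem_iff (A.map hΔ.repr) (FormIn.mem_freeVars_map _ hx)).trans
      (exists_congr fun _ => (hΔ.val_inst A _).symm)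
  negAll A hx := (hΔ.val_eq_true _).trans <|
    (hΔ.neg_all_mem_iff (A.map hΔ.repr) (FormIn.mem_freeVars_map _ hx)).trans
      (exists_congr fun _ => (hΔ.val_inst A.neg _).symm)
  negEx A hx := (hΔ.val_eq_true _).trans <|
    (hΔ.neg_ex_mem_iff (A.map hΔ.repr) (FormIn.mem_freeVars_map _ hx)).trans
      (forall_congr' fun _ => (hΔ.val_inst A.neg _).symm)
  alpha A A' h := by
    rw [Bool.eq_iff_iff, val_eq_true, val_eq_true]
    exact ⟨fun hA => hΔ.closed (.av (h.symm.map _) (.hyp hA)),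
      fun hA => hΔ.closed (.av (h.map _) (.hyp hA))⟩
  congr {x} A c₁ c₂ hc _ := by
    -- Constants with the same denotation have provably identical representatives, so `≈E` makes
    -- them interchangeable in every formula, in particular in `¬A`, `∘A` and `•A`.
    have key (B : hΔ.struc.diagram.FormIn x) : hΔ.val (B.inst c₁) = hΔ.val (B.inst c₂) :=
      Bool.eq_iff_iff.2 <| (hΔ.val_inst B c₁).trans <|
        (hΔ.inst_mem_iff (B.map hΔ.repr) (hΔ.eqSent_repr hc)).trans (hΔ.val_inst B c₂).symm
    exact ⟨key A.neg, key A.circ, key A.bull⟩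

theorem val_incl (h : IsHenkin Δ) (A : S.Sent) :
    h.val (h.struc.incl A) = true ↔ (A.map HenkinConst.base : S.henkin.Sent) ∈ Δ := by
  rw [val_eq_true]
  exact iff_of_eq (congrArg (· ∈ Δ) (Subtype.ext (PreForm.map_map _ _ _)))

end IsHenkin

theorem Proves.of_entails {Γ : Set S.Sent} {A : S.Sent} (h : S.Entails Γ A) : S.Proves Γ A := by
  by_contra hn
  -- Sentences of the original language contain no witnesses, so every witness is fresh at the
  -- start.
  have hbase : ∀ (B : S.Sent) (F : PreForm (HenkinConst S.Const S.Pred) S.Pred),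
      HenkinConst.wit F ∉ (B.map HenkinConst.base : S.henkin.Sent).1.consts := by
    intro B F hF
    obtain ⟨c, -, hc⟩ := PreForm.consts_map_subset _ _ hF
    cases hc
  obtain ⟨Δ, hΓΔ, hΔ, hA⟩ := exists_isHenkin (T := Sentence.map HenkinConst.base '' Γ)
    (D := A.map HenkinConst.base) (by rintro _ ⟨B, -, rfl⟩; exact hbase B) (hbase A)
    fun h' => hn (.of_map HenkinConst.base (fun _ _ => HenkinConst.base.inj) h')
  exact hA ((hΔ.val_incl A).1 (h hΔ.struc hΔ.val (hΔ.isValuation hA)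
    fun B hB => (hΔ.val_incl B).2 (hΓΔ ⟨B, hB, rfl⟩)))

end Signature

end QLETF

theorem mainTheorem1 (S : QLETF.Signature.{u}) (Γ : Set S.Sent) (A : S.Sent)
    (h : S.Entails Γ A) : S.Proves Γ A := by
  exact .of_entails h
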